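/- Let $m\ge 1$ and let $(M,g)$ be an $m$-dimensional oriented smooth Riemannian manifold with Levi-Civita connection $\nabla$. Definitions. For a smooth curve $\sigma\colon(a,b)\to M$ with tangent field $T^\sigma$, write $\nabla_{T^\sigma}^kT^\sigma$ for its iterated covariant derivatives along $\sigma$. The curve $\sigma$ is a *Frenet curve* if $T^\sigma,\nabla_{T^\sigma}T^\sigma,\dots,\nabla_{T^\sigma}^{m-2}T^\sigma$ are linearly independent at every $t\in(a,b)$ (no condition if $m=1$). Its *Frenet frame* $(X_1^\sigma,\dots,X_m^\sigma)$ and *curvatures* $\kappa_0^\sigma,\dots,\kappa_{m-1}^\sigma$ are the smooth vector fields along $\sigma$ and the smooth functions on $(a,b)$, with $\kappa_j^\sigma>0$ for $0\le j\le m-2$, such that for all $t\in(a,b)$: (a) $(X_1^\sigma(t),\dots,X_m^\sigma(t))$ is a positively oriented orthonormal basis of $T_{\sigma(t)}M$; (b) for $1\le i\le m-1$, the systems $(X_1^\sigma(t),\dots,X_i^\sigma(t))$ and $(T^\sigma_t,(\nabla_{T^\sigma}T^\sigma)_t,\dots,(\nabla_{T^\sigma}^{i-1}T^\sigma)_t)$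 span the same subspace and are equally oriented; (c) $T^\sigma=\kappa_0^\sigma X_1^\sigma$ and, for $1\le i\le m$, $$\nabla_{T^\sigma}X_i^\sigma=\kappa_0^\sigma\left(-\kappa_{i-1}^\sigma X_{i-1}^\sigma+\kappa_i^\sigma X_{i+1}^\sigma\right),$$ where the term with $X_{i-1}^\sigma$ is omitted for $i=1$ and the term with $X_{i+1}^\sigma$ is omitted for $i=m$. (For $m\ge 2$ this says $\nabla_{X_1^\sigma}X_i^\sigma=-\kappa_{i-1}^\sigma X_{i-1}^\sigma+\kappa_i^\sigma X_{i+1}^\sigma$.) Theorem. Let $x_0\in M$, let $(v_1,\dots,v_m)$ be a positively oriented orthonormal basis of $T_{x_0}M$, let $t_0\in\mathbb{R}$ and $\delta>0$, and let $\kappa_j\in C^\infty(t_0-\delta,t_0+\delta)$, $0\le j\le m-1$, with $\kappa_j>0$ for $0\le j\le m-2$. Then there exist $\varepsilon$ with $0<\varepsilon\le\delta$ and a unique Frenet curve $\sigma\colon(t_0-\varepsilon,t_0+\varepsilon)\to M$ such that (i) $\sigma(t_0)=x_0$; (ii) $X_j^\sigma(t_0)=v_j$ for $1\le j\le m$; (iii)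 $\kappa_j^\sigma=\kappa_j$ on $(t_0-\varepsilon,t_0+\varepsilon)$ for $0\le j\le m-1$. -/

import Mathlib

open Set Filter Bundle
open scoped Manifold ContDiff Topology

noncomputable section

namespace FrenetTheory

variable {m : ℕ} {M : Type*} [TopologicalSpace M] [ChartedSpace (EuclideanSpace ℝ (Fin m)) M]
  [IsManifold (𝓡 m) ∞ M]

/-- A smooth Riemannian metric on a smooth `m`-manifold `M`. -/
abbrev Metric (m : ℕ) (M : Type*) [TopologicalSpace M]
    [ChartedSpace (EuclideanSpace ℝ (Fin m)) M] [IsManifold (𝓡 m) ∞ M] :=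
  ContMDiffRiemannianMetric (𝓡 m) ∞ (EuclideanSpace ℝ (Fin m))
    (fun x : M => TangentSpace (𝓡 m) x)

/-- The local trivialization of the tangent bundle given by the preferred chart at `x`: its fibre
over `y` is the isomorphism `T_y M → ℝ^m` reading off components in the coordinate basis. -/
abbrev tangentTriv (m : ℕ) {M : Type*} [TopologicalSpace M]
    [ChartedSpace (EuclideanSpace ℝ (Fin m)) M] [IsManifold (𝓡 m) ∞ M] (x : M) :
    Trivialization (EuclideanSpace ℝ (Fin m))
      (TotalSpace.proj : TangentBundle (𝓡 m) M → M) :=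
  trivializationAt (EuclideanSpace ℝ (Fin m)) (fun y : M => TangentSpace (𝓡 m) y) x

/-! ### Orientations -/

/-- An orientation of the manifold `M`: an orientation of each tangent space which, read in the
coordinates around any point `x`, is constant near `x`. -/
structure ManifoldOrientation (m : ℕ) (M : Type*) [TopologicalSpace M]
    [ChartedSpace (EuclideanSpace ℝ (Fin m)) M] [IsManifold (𝓡 m) ∞ M] where
  /-- The orientation of the tangent space at `x`. -/
  orientationAt : ∀ x : M, Orientation ℝ (TangentSpace (𝓡 m) x) (Fin m)
  locally_constant : ∀ x : M, ∀ᶠ y in 𝓝 x, ∀ hy : y ∈ (tangentTriv m x).baseSet,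
    Orientation.map (Fin m) ((tangentTriv m x).linearEquivAt ℝ y hy) (orientationAt y) =
      Orientation.map (Fin m)
        ((tangentTriv m x).linearEquivAt ℝ x (mem_baseSet_trivializationAt _ _ x))
        (orientationAt x)

/-- The family `v` is a positively oriented basis of the tangent space at `x`. -/
def IsPositivelyOriented (o : ManifoldOrientation m M) (x : M)
    (v : Fin m → TangentSpace (𝓡 m) x) : Prop :=
  ∃ b : Module.Basis (Fin m) ℝ (TangentSpace (𝓡 m) x),
    (∀ i, b i = v i) ∧ b.orientation = o.orientationAt x

/-- The family `v` in the tangent space at `x` is orthonormal for `g`. -/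
def IsOrthonormal (g : Metric m M) (x : M) (v : Fin m → TangentSpace (𝓡 m) x) : Prop :=
  ∀ i j, g.inner x (v i) (v j) = if i = j then 1 else 0

/-- Two `k`-tuples of vectors span the same subspace and are equally oriented (the second is
obtained from the first by a matrix of positive determinant). -/
def SameSpanAndOrientation {V : Type*} [AddCommGroup V] [Module ℝ V] {k : ℕ}
    (v w : Fin k → V) : Prop :=
  Submodule.span ℝ (range v) = Submodule.span ℝ (range w) ∧
    ∃ A : Matrix (Fin k) (Fin k) ℝ, 0 < A.det ∧ ∀ i, w i = ∑ j, A i j • v j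

/-! ### The Levi-Civita connection along curves -/

/-- The components `g_{ij}` of the metric in the preferred chart at `x`, as a function of the
coordinates `y`, assembled into a bilinear form on `ℝ^m`. -/
def metricInChart (g : Metric m M) (x : M) (y : EuclideanSpace ℝ (Fin m)) :
    EuclideanSpace ℝ (Fin m) →L[ℝ] EuclideanSpace ℝ (Fin m) →L[ℝ] ℝ :=
  let p := (extChartAt (𝓡 m) x).symm y
  let φ := (tangentTriv m x).symmL ℝ p
  (ContinuousLinearMap.precomp ℝ φ).comp ((g.inner p).comp φ)

lemma metricInChart_apply (g : Metric m M) (x : M) (y u v : EuclideanSpace ℝ (Fin m)) :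
    metricInChart g x y u v =
      g.inner ((extChartAt (𝓡 m) x).symm y)
        ((tangentTriv m x).symmL ℝ ((extChartAt (𝓡 m) x).symm y) u)
        ((tangentTriv m x).symmL ℝ ((extChartAt (𝓡 m) x).symm y) v) :=
  rfl

/-- The Christoffel symbols of the Levi-Civita connection of `g` in the preferred chart at `x`:
`christoffel g x y u v` is the vector with components `Γ^c_{ab}(y) u^a v^b`, characterized by
`g(Γ(u, v), w) = 1/2 (∂_u g(v, w) + ∂_v g(u, w) - ∂_w g(u, v))`.
The form `metricInChart g x y` is inverted as a map from `ℝ^m` to its dual. -/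
def christoffel (g : Metric m M) (x : M) (y u v : EuclideanSpace ℝ (Fin m)) :
    EuclideanSpace ℝ (Fin m) :=
  let dG := fderiv ℝ (metricInChart g x) y
  (metricInChart g x y).inverse
    ((1 / 2 : ℝ) • (dG u v + dG v u - (dG.flip u).flip v))

/-- The tangent field `T^σ` of a curve. -/
def velocity (σ : ℝ → M) (t : ℝ) : TangentSpace (𝓡 m) (σ t) :=
  mfderiv 𝓘(ℝ, ℝ) (𝓡 m) σ t (1 : ℝ)

/-- The components at time `s` of a vector field `V` along `σ`, in the preferred chart at `x`. -/
def components (x : M) (σ : ℝ → M) (V : ∀ t, TangentSpace (𝓡 m) (σ t)) (s : ℝ) :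
    EuclideanSpace ℝ (Fin m) :=
  (tangentTriv m x (⟨σ s, V s⟩ : TangentBundle (𝓡 m) M)).2

/-- The Levi-Civita covariant derivative `∇_{T^σ} V` of a vector field `V` along `σ`: in the
coordinates around `σ t` its components are `dV^c/dt + Γ^c_{ab} (T^σ)^a V^b`. -/
def covDerivAlong (g : Metric m M) (σ : ℝ → M) (V : ∀ t, TangentSpace (𝓡 m) (σ t)) (t : ℝ) :
    TangentSpace (𝓡 m) (σ t) :=
  (tangentTriv m (σ t)).symmL ℝ (σ t)
    (deriv (components (σ t) σ V) t +
      christoffel g (σ t) (extChartAt (𝓡 m) (σ t) (σ t))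
        (components (σ t) σ (velocity σ) t) (components (σ t) σ V t))

/-- The iterated covariant derivative `∇_{T^σ}^k T^σ`. -/
def iterCovDeriv (g : Metric m M) (σ : ℝ → M) (k : ℕ) : ∀ t, TangentSpace (𝓡 m) (σ t) :=
  (covDerivAlong g σ)^[k] (velocity σ)

/-! ### Frenet curves -/

/-- General position up to order `r` at `t`: the vectors `T^σ, ∇T^σ, …, ∇^{r-1}T^σ` are linearly
independent at `t`. -/
def InGeneralPosition (g : Metric m M) (σ : ℝ → M) (r : ℕ) (t : ℝ) : Prop :=
  LinearIndependent ℝ (fun i : Fin r => iterCovDeriv g σ i t)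

/-- `σ`, restricted to the open interval `s`, is a Frenet curve: a smooth curve in general position
up to order `m - 1`. -/
def IsFrenetCurve (g : Metric m M) (σ : ℝ → M) (s : Set ℝ) : Prop :=
  ContMDiffOn 𝓘(ℝ, ℝ) (𝓡 m) ∞ σ s ∧ ∀ t ∈ s, InGeneralPosition g σ (m - 1) t

/-- `X` is the Frenet frame and `κ` are the curvatures of `σ` on the open interval `s`.
Frames are indexed from `0`, so `X i` is the field `X_{i+1}` of the usual notation, while `κ j` is
`κ_j`. Since `T^σ = κ_0 X_1`, the operator `∇_{T^σ}` is `κ_0 ∇_{X_1}`, and the Frenet formulas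
`∇_{X_1} X_i = -κ_{i-1} X_{i-1} + κ_i X_{i+1}` (without the term in `X_0` for `i = 1` and without
the term in `X_{m+1}` for `i = m`) are written multiplied by `κ_0`. -/
structure IsFrenetFrame [NeZero m] (g : Metric m M) (o : ManifoldOrientation m M) (σ : ℝ → M)
    (s : Set ℝ) (X : Fin m → ∀ t, TangentSpace (𝓡 m) (σ t)) (κ : Fin m → ℝ → ℝ) : Prop where
  smooth_frame : ∀ i, ContMDiffOn 𝓘(ℝ, ℝ) (𝓡 m).tangent ∞
    (fun t => (⟨σ t, X i t⟩ : TangentBundle (𝓡 m) M)) s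
  smooth_curvature : ∀ j, ContDiffOn ℝ ∞ (κ j) s
  curvature_pos : ∀ j : Fin m, (j : ℕ) + 1 < m → ∀ t ∈ s, 0 < κ j t
  orthonormal : ∀ t ∈ s, IsOrthonormal g (σ t) (fun i => X i t)
  positive : ∀ t ∈ s, IsPositivelyOriented o (σ t) (fun i => X i t)
  osculating : ∀ (k : ℕ) (_ : 1 ≤ k) (hk : k < m), ∀ t ∈ s,
    SameSpanAndOrientation (fun i : Fin k => X ⟨i, i.isLt.trans hk⟩ t)
      (fun i : Fin k => iterCovDeriv g σ i t)
  velocity_eq : ∀ t ∈ s, velocity σ t = κ 0 t • X 0 t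
  frenet : ∀ i : Fin m, ∀ t ∈ s, covDerivAlong g σ (X i) t = κ 0 t •
    ((if h : (i : ℕ) + 1 < m then κ ⟨i + 1, h⟩ t • X ⟨i + 1, h⟩ t else 0) -
      (if 0 < (i : ℕ) then κ i t • X ⟨i - 1, (Nat.sub_le _ _).trans_lt i.isLt⟩ t else 0))

/-- `σ` is a Frenet curve on the open interval `s` with curvatures `κ`, passing through `x₀` at
time `t₀`, where its Frenet frame is `v`. -/
def IsFrenetSolution [NeZero m] (g : Metric m M) (o : ManifoldOrientation m M) (x₀ : M)
    (v : Fin m → TangentSpace (𝓡 m) x₀) (κ : Fin m → ℝ → ℝ) (t₀ : ℝ) (s : Set ℝ)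
    (σ : ℝ → M) : Prop :=
  IsFrenetCurve g σ s ∧
    ∃ X : Fin m → ∀ t, TangentSpace (𝓡 m) (σ t),
      IsFrenetFrame g o σ s X κ ∧ σ t₀ = x₀ ∧
        ∀ j, (⟨σ t₀, X j t₀⟩ : TangentBundle (𝓡 m) M) = ⟨x₀, v j⟩

end FrenetTheory

end

/-! In a chart, prescribing the curvatures turns the Frenet formulas and `T = κ₀ X₁` into a
first-order system for the coordinates of the curve and the components of its frame (`frenetField`).
Its right-hand side is smooth because the Christoffel symbols are, so a smooth local solution exists
(`exists_smooth_solution`).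

The solution of this system is a Frenet curve with its frame for three reasons. The Frenet matrix is
antisymmetric and the connection is metric, so the Gram matrix of the frame stays the identity
(`orthonormal_of_frenetField`). The sign of a determinant is locally constant, so after shrinking
the interval the frame stays positively oriented (`eventually_isPositivelyOriented`). The Frenet
matrix is tridiagonal with positive relevant superdiagonal entries, so the iterated covariant
derivatives of the velocity are a triangular combination of the frame with positive diagonal, which
gives the osculating condition and general position (`exists_iterCovDeriv_eq`,
`osculating_of_frenet`).

Uniqueness: every Frenet frame solves the system in every chart, so two of them agree near any time
at which they agree. Since `M` is Hausdorff, agreement is also a closed condition and spreads over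
the interval (`IsFrenetSolution.eqOn`). Changing charts relies on `coord_covDerivAlong`: the
covariant derivative, defined in the chart centred at `σ t`, has the same expression in any chart,
by the transformation law of the Christoffel symbols. -/

noncomputable section

namespace FrenetTheory

/-! ### Christoffel symbols of a metric on a vector space -/

section Christoffel

variable {E : Type*} [NormedAddCommGroup E] [NormedSpace ℝ E]

instance instNormedAddCommGroupBilin : NormedAddCommGroup (E →L[ℝ] E →L[ℝ] ℝ) := inferInstance

instance instNormedSpaceBilin : NormedSpace ℝ (E →L[ℝ] E →L[ℝ] ℝ) := inferInstance

instance instNormedAddCommGroupTrilin : NormedAddCommGroup (E →L[ℝ] E →L[ℝ] E →L[ℝ] ℝ) :=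
  inferInstance

instance instNormedSpaceTrilin : NormedSpace ℝ (E →L[ℝ] E →L[ℝ] E →L[ℝ] ℝ) := inferInstance

lemma hasDerivAt_bilin_apply {B : ℝ → E →L[ℝ] E →L[ℝ] ℝ} {B' : E →L[ℝ] E →L[ℝ] ℝ}
    {a b : ℝ → E} {a' b' : E} {t : ℝ} (hB : HasDerivAt B B' t) (ha : HasDerivAt a a' t)
    (hb : HasDerivAt b b' t) : HasDerivAt (fun s => B s (a s) (b s))
      (B' (a t) (b t) + B t a' (b t) + B t (a t) b') t := by
  simpa using (hB.clm_apply ha).clm_apply hb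

lemma hasDerivAt_line (y c : E) : HasDerivAt (fun s : ℝ => y + s • c) c 0 := by
  simpa using ((hasDerivAt_id (0 : ℝ)).smul_const c).const_add y

lemma tendsto_line (y c : E) : Tendsto (fun s : ℝ => y + s • c) (𝓝 0) (𝓝 y) := by
  simpa using (hasDerivAt_line y c).continuousAt.tendsto

lemma hasDerivAt_comp_line {W : Type*} [NormedAddCommGroup W] [NormedSpace ℝ W] {f : E → W}
    {y : E} (hf : DifferentiableAt ℝ f y) (c : E) :
    HasDerivAt (fun s : ℝ => f (y + s • c)) (fderiv ℝ f y c) 0 := by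
  have h0 : DifferentiableAt ℝ f (y + (0 : ℝ) • c) := by simpa using hf
  simpa [Function.comp_def] using h0.hasFDerivAt.comp_hasDerivAt (0 : ℝ) (hasDerivAt_line y c)

lemma hasDerivAt_metric_line {G : E → E →L[ℝ] E →L[ℝ] ℝ} {y : E}
    (hG : DifferentiableAt ℝ G y) (c a b : E) :
    HasDerivAt (fun s : ℝ => G (y + s • c) a b) (fderiv ℝ G y c a b) 0 := by
  simpa using hasDerivAt_bilin_apply (hasDerivAt_comp_line hG c) (hasDerivAt_const _ a)
    (hasDerivAt_const _ b)

/-- The Christoffel symbols of a metric `G` on (an open subset of) a vector space. -/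
def christoffelOf (G : E → E →L[ℝ] E →L[ℝ] ℝ) (y u v : E) : E :=
  let dG := fderiv ℝ G y
  (G y).inverse ((1 / 2 : ℝ) • (dG u v + dG v u - (dG.flip u).flip v))

/-- A nondegenerate form on a finite-dimensional space is invertible as a map to the dual. -/
lemma isInvertible_of_pos [FiniteDimensional ℝ E] {B : E →L[ℝ] E →L[ℝ] ℝ}
    (hB : ∀ v, v ≠ 0 → 0 < B v v) : B.IsInvertible := by
  have hinj : Function.Injective (B : E →ₗ[ℝ] (E →L[ℝ] ℝ)) := by
    rw [← LinearMap.ker_eq_bot, LinearMap.ker_eq_bot']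
    intro v hv
    by_contra hne
    have := hB v hne
    have h0 : B v = 0 := hv
    simp [h0] at this
  have hfin : Module.finrank ℝ E = Module.finrank ℝ (E →L[ℝ] ℝ) := by
    rw [← (LinearMap.toContinuousLinearMap (𝕜 := ℝ) (E := E) (F' := ℝ)).finrank_eq]
    exact (Subspace.dual_finrank_eq (K := ℝ) (V := E)).symm
  refine ⟨(LinearEquiv.ofInjectiveOfFinrankEq (B : E →ₗ[ℝ] (E →L[ℝ] ℝ)) hinj
    hfin).toContinuousLinearEquiv, ?_⟩
  ext v w
  rfl

/-- The Koszul formula. Compatibility with the metric and the transformation law are both deduced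
from it by pairing with `G`. -/
lemma christoffelOf_apply {G : E → E →L[ℝ] E →L[ℝ] ℝ} {y : E} (hG : (G y).IsInvertible)
    (u v w : E) : G y (christoffelOf G y u v) w =
      1 / 2 * (fderiv ℝ G y u v w + fderiv ℝ G y v u w - fderiv ℝ G y w u v) := by
  have : G y (christoffelOf G y u v) = (1 / 2 : ℝ) • (fderiv ℝ G y u v + fderiv ℝ G y v u -
      ((fderiv ℝ G y).flip u).flip v) := by
    obtain ⟨e, he⟩ := hG
    simp only [christoffelOf, ← he, ContinuousLinearMap.inverse_equiv]
    exact e.apply_symm_apply _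
  rw [this]
  simp

lemma eq_of_forall_pairing_eq {B : E →L[ℝ] E →L[ℝ] ℝ} (hB : B.IsInvertible) {a b : E}
    (h : ∀ w, B a w = B b w) : a = b := by
  obtain ⟨e, rfl⟩ := hB
  exact e.injective (ContinuousLinearMap.ext h)

lemma fderiv_symm_of_symm {G : E → E →L[ℝ] E →L[ℝ] ℝ} {y : E} (hG : DifferentiableAt ℝ G y)
    (hs : ∀ᶠ z in 𝓝 y, ∀ a b, G z a b = G z b a) (u v w : E) :
    fderiv ℝ G y u v w = fderiv ℝ G y u w v := by
  refine (hasDerivAt_metric_line hG u v w).unique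
    ((hasDerivAt_metric_line hG u w v).congr_of_eventuallyEq ?_)
  exact (tendsto_line y u).eventually (hs.mono fun z hz => hz v w)

/-- Compatibility of the Christoffel symbols with the metric. -/
lemma christoffelOf_compat {G : E → E →L[ℝ] E →L[ℝ] ℝ} {y : E} (hG : DifferentiableAt ℝ G y)
    (hi : (G y).IsInvertible) (hs : ∀ᶠ z in 𝓝 y, ∀ a b, G z a b = G z b a) (w u v : E) :
    fderiv ℝ G y w u v = G y (christoffelOf G y w u) v + G y u (christoffelOf G y w v) := by
  rw [hs.self_of_nhds u, christoffelOf_apply hi, christoffelOf_apply hi,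
    fderiv_symm_of_symm hG hs w v u, fderiv_symm_of_symm hG hs u w v,
    fderiv_symm_of_symm hG hs v w u]
  ring

/-- Metric compatibility of the covariant derivative along a curve. -/
lemma hasDerivAt_metric {G : E → E →L[ℝ] E →L[ℝ] ℝ} {y a b : ℝ → E} {y' a' b' : E} {t : ℝ}
    (hG : DifferentiableAt ℝ G (y t)) (hi : (G (y t)).IsInvertible)
    (hs : ∀ᶠ z in 𝓝 (y t), ∀ c d, G z c d = G z d c)
    (hy : HasDerivAt y y' t) (ha : HasDerivAt a a' t) (hb : HasDerivAt b b' t) :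
    HasDerivAt (fun s => G (y s) (a s) (b s))
      (G (y t) (a' + christoffelOf G (y t) y' (a t)) (b t) +
        G (y t) (a t) (b' + christoffelOf G (y t) y' (b t))) t := by
  have h := hasDerivAt_bilin_apply (hG.hasFDerivAt.comp_hasDerivAt t hy) ha hb
  refine h.congr_deriv ?_
  have hc := christoffelOf_compat hG hi hs y' (a t) (b t)
  simp only [Function.comp, map_add, _root_.add_apply] at hc ⊢
  rw [hc]
  ring

/-- The transformation law of the Christoffel symbols under a change of coordinates `ψ`. -/
lemma christoffelOf_transform {G G' : E → E →L[ℝ] E →L[ℝ] ℝ} {ψ : E → E} {y : E}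
    (hψ : ContDiffAt ℝ 2 ψ y) (hsurj : Function.Surjective (fderiv ℝ ψ y))
    (hG' : DifferentiableAt ℝ G' (ψ y)) (hi : (G y).IsInvertible) (hi' : (G' (ψ y)).IsInvertible)
    (hs' : ∀ᶠ z in 𝓝 (ψ y), ∀ a b, G' z a b = G' z b a)
    (hGG' : ∀ᶠ z in 𝓝 y, ∀ a b, G z a b = G' (ψ z) (fderiv ℝ ψ z a) (fderiv ℝ ψ z b))
    (u v : E) (hG : DifferentiableAt ℝ G y) :
    fderiv ℝ ψ y (christoffelOf G y u v) =
      christoffelOf G' (ψ y) (fderiv ℝ ψ y u) (fderiv ℝ ψ y v) +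
        fderiv ℝ (fderiv ℝ ψ) y u v := by
  have hD : DifferentiableAt ℝ (fderiv ℝ ψ) y :=
    (hψ.fderiv_right (m := 1) (by norm_num)).differentiableAt one_ne_zero
  have hψd : DifferentiableAt ℝ ψ y := hψ.differentiableAt two_ne_zero
  have hsym : IsSymmSndFDerivAt ℝ ψ y := hψ.isSymmSndFDerivAt (by simp)
  -- Product rule for the pullback relation `hGG'`, differentiated in the direction `c`.
  have key : ∀ c a b, fderiv ℝ G y c a b =
      fderiv ℝ G' (ψ y) (fderiv ℝ ψ y c) (fderiv ℝ ψ y a) (fderiv ℝ ψ y b) +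
      G' (ψ y) (fderiv ℝ (fderiv ℝ ψ) y c a) (fderiv ℝ ψ y b) +
      G' (ψ y) (fderiv ℝ ψ y a) (fderiv ℝ (fderiv ℝ ψ) y c b) := by
    intro c a b
    have h2 := hasDerivAt_bilin_apply (B := fun s : ℝ => G' (ψ (y + s • c)))
      (a := fun s : ℝ => fderiv ℝ ψ (y + s • c) a) (b := fun s : ℝ => fderiv ℝ ψ (y + s • c) b)
      (hasDerivAt_comp_line (hG'.comp y hψd) c)
      ((hasDerivAt_comp_line hD c).clm_apply (hasDerivAt_const _ a))
      ((hasDerivAt_comp_line hD c).clm_apply (hasDerivAt_const _ b))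
    have h3 := (hasDerivAt_metric_line hG c a b).unique (h2.congr_of_eventuallyEq
      ((tendsto_line y c).eventually (hGG'.mono fun z hz => hz a b)))
    rw [h3, fderiv_comp y hG' hψd]
    simp

  -- By surjectivity of `Dψ` it suffices to pair with vectors `Dψ w`. In the Koszul combination the
  -- symmetry of `D²ψ` cancels all second-order terms except the two equal to `G'(D²ψ(u, v), Dψ w)`.
  refine eq_of_forall_pairing_eq hi' fun w' => ?_
  obtain ⟨w, rfl⟩ := hsurj w'
  rw [← hGG'.self_of_nhds, christoffelOf_apply hi, key, key, key, map_add,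
    _root_.add_apply, christoffelOf_apply hi', hsym.eq v u, hsym.eq w u,
    hsym.eq w v, hs'.self_of_nhds (fderiv ℝ ψ y v)]
  ring

/-- Operator inversion is smooth at invertible operators; the remaining ingredients are linear in
`fderiv ℝ G` and in the vectors. -/
lemma contDiffAt_christoffelOf [CompleteSpace E] {G : E → E →L[ℝ] E →L[ℝ] ℝ} {y : E}
    (hG : ContDiffAt ℝ ∞ G y) (hi : (G y).IsInvertible) (u v : E) :
    ContDiffAt ℝ ∞ (fun p : E × E × E => christoffelOf G p.1 p.2.1 p.2.2) (y, u, v) := by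
  have h1 : ContDiffAt ℝ ∞ (fun p : E × E × E => (G p.1).inverse) (y, u, v) :=
    (hi.contDiffAt_map_inverse.comp y hG).comp (y, u, v) contDiffAt_fst
  have h2 : ContDiffAt ℝ ∞ (fun p : E × E × E => fderiv ℝ G p.1) (y, u, v) :=
    (hG.fderiv_right (m := ∞) (by simp)).comp (y, u, v) contDiffAt_fst
  have hu : ContDiffAt ℝ ∞ (fun p : E × E × E => p.2.1) (y, u, v) := by fun_prop
  have hv : ContDiffAt ℝ ∞ (fun p : E × E × E => p.2.2) (y, u, v) := by fun_prop
  have h3 : ContDiffAt ℝ ∞ (fun p : E × E × E => (fderiv ℝ G p.1).flip) (y, u, v) :=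
    (ContinuousLinearMap.flipₗᵢ ℝ E E (E →L[ℝ] ℝ)).contDiff.contDiffAt.comp _ h2
  have h4 : ContDiffAt ℝ ∞ (fun p : E × E × E => ((fderiv ℝ G p.1).flip p.2.1).flip)
      (y, u, v) :=
    (ContinuousLinearMap.flipₗᵢ ℝ E E ℝ).contDiff.contDiffAt.comp _ (h3.clm_apply hu)
  exact h1.clm_apply (((((h2.clm_apply hu).clm_apply hv).add
    ((h2.clm_apply hv).clm_apply hu)).sub (h4.clm_apply hv)).const_smul _)

end Christoffel

/-! ### Time-dependent ordinary differential equations -/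

section ODE

variable {Z : Type*} [NormedAddCommGroup Z] [NormedSpace ℝ Z]

/-- Local existence of smooth solutions of a smooth time-dependent ODE. -/
lemma exists_smooth_solution [CompleteSpace Z] {F : ℝ × Z → Z} {U : Set (ℝ × Z)}
    (hU : IsOpen U) (hF : ContDiffOn ℝ ∞ F U) {t₀ : ℝ} {z₀ : Z} (h₀ : (t₀, z₀) ∈ U) :
    ∃ α : ℝ → Z, α t₀ = z₀ ∧ ∃ ε > (0 : ℝ), ContDiffOn ℝ ∞ α (Ioo (t₀ - ε) (t₀ + ε)) ∧
      ∀ t ∈ Ioo (t₀ - ε) (t₀ + ε), (t, α t) ∈ U ∧ HasDerivAt α (F (t, α t)) t := by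
  -- Time is adjoined as an unknown with derivative `1`, which makes the equation autonomous.
  let f : ℝ × Z → ℝ × Z := fun p => (1, F p)
  have hf : ContDiffOn ℝ ∞ f U := contDiffOn_const.prodMk hF
  have hf0 : ContDiffAt ℝ 1 f (t₀, z₀) :=
    (hf.contDiffAt (hU.mem_nhds h₀)).of_le (by exact_mod_cast le_top)
  obtain ⟨β, hβ0, ε, hε, hβ⟩ :=
    hf0.exists_forall_mem_closedBall_exists_eq_forall_mem_Ioo_hasDerivAt₀ t₀
  have hβ1 : ∀ t ∈ Ioo (t₀ - ε) (t₀ + ε), (β t).1 = t := by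
    have hd : ∀ t ∈ Ioo (t₀ - ε) (t₀ + ε), HasDerivAt (fun s => (β s).1) 1 t := fun t ht =>
      (hasFDerivAt_fst (p := β t)).comp_hasDerivAt t (hβ t ht)
    have := isOpen_Ioo.eqOn_of_deriv_eq (f := fun s => (β s).1) (g := fun s : ℝ => s)
      isPreconnected_Ioo
      (fun t ht => (hd t ht).differentiableAt.differentiableWithinAt) differentiableOn_id
      (fun t ht => by rw [(hd t ht).deriv]; simp) (x := t₀) (by simp [hε]) (by simp [hβ0])
    exact this
  have ht₀ : t₀ ∈ Ioo (t₀ - ε) (t₀ + ε) := by simp [hε]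
  have hmem : ∀ᶠ t in 𝓝 t₀, β t ∈ U :=
    (hβ t₀ ht₀).continuousAt.eventually_mem (by rw [hβ0]; exact hU.mem_nhds h₀)
  obtain ⟨η, hη, hηU⟩ := Metric.eventually_nhds_iff_ball.1
    (hmem.and (isOpen_Ioo.mem_nhds ht₀ : ∀ᶠ t in 𝓝 t₀, t ∈ Ioo (t₀ - ε) (t₀ + ε)))
  have hsub : Icc (t₀ - η / 2) (t₀ + η / 2) ⊆ Metric.ball t₀ η := by
    rw [Real.ball_eq_Ioo]
    exact Icc_subset_Ioo (by linarith) (by linarith)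
  -- Existence only yields differentiability; smoothness follows by bootstrapping through the
  -- equation, on a closed interval, hence the radius `η / 2`.
  have hsm : ContDiffOn ℝ ∞ β (Icc (t₀ - η / 2) (t₀ + η / 2)) := by
    refine ODE.contDiffOn_enat_Icc_of_hasDerivWithinAt (n := ⊤) (f := fun _ z => f z) (u := U)
      ?_ (fun t ht => (hβ t (hηU t (hsub ht)).2).hasDerivWithinAt)
      (fun t ht => (hηU t (hsub ht)).1)
    exact hf.comp contDiffOn_snd fun p hp => hp.2
  refine ⟨fun t => (β t).2, by simp [hβ0], η / 2, by positivity,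
    contDiff_snd.comp_contDiffOn (hsm.mono Ioo_subset_Icc_self), fun t ht => ?_⟩
  obtain ⟨hU', hI⟩ := hηU t (hsub (Ioo_subset_Icc_self ht))
  have e : (t, (β t).2) = β t := Prod.ext (hβ1 t hI).symm rfl
  rw [e]
  exact ⟨hU', (hasFDerivAt_snd (p := β t)).comp_hasDerivAt t (hβ t hI)⟩

/-- Local uniqueness of solutions of a `C¹` time-dependent ODE. -/
lemma eventuallyEq_of_solution {F : ℝ × Z → Z} {α β : ℝ → Z} {t₀ : ℝ}
    (hF : ContDiffAt ℝ 1 F (t₀, α t₀)) (hα : ∀ᶠ t in 𝓝 t₀, HasDerivAt α (F (t, α t)) t)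
    (hβ : ∀ᶠ t in 𝓝 t₀, HasDerivAt β (F (t, β t)) t) (h : α t₀ = β t₀) :
    α =ᶠ[𝓝 t₀] β := by
  let f : ℝ × Z → ℝ × Z := fun p => (1, F p)
  have hf : ContDiffAt ℝ 1 f (t₀, α t₀) := contDiffAt_const.prodMk hF
  obtain ⟨K, s, hs, hK⟩ := hf.exists_lipschitzOnWith
  have aux : ∀ γ : ℝ → Z, γ t₀ = α t₀ → (∀ᶠ t in 𝓝 t₀, HasDerivAt γ (F (t, γ t)) t) →
      ∀ᶠ t in 𝓝 t₀, HasDerivAt (fun r => (r, γ r)) (f (t, γ t)) t ∧ (t, γ t) ∈ s := by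
    intro γ hγ0 hγ
    have hc : ContinuousAt (fun r => (r, γ r)) t₀ :=
      continuousAt_id.prodMk hγ.self_of_nhds.continuousAt
    have hm : ∀ᶠ t in 𝓝 t₀, (t, γ t) ∈ s := hc.eventually_mem (by simpa [hγ0] using hs)
    filter_upwards [hγ, hm] with t h1 h2
    exact ⟨(hasDerivAt_id t).prodMk h1, h2⟩
  have := ODE_solution_unique_of_eventually (v := fun _ => f) (s := fun _ => s) (K := K)
    (Eventually.of_forall fun _ => hK) (aux α rfl hα) (aux β h.symm hβ) (by simp [h])
  filter_upwards [this] with t ht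
  exact congrArg Prod.snd ht

/-- A Gram matrix evolving by an antisymmetric matrix stays equal to the identity. -/
lemma gram_eq_one_of_antisymm {m : ℕ} {h A : ℝ → Fin m → Fin m → ℝ} {a b t₀ : ℝ}
    (ht₀ : t₀ ∈ Ioo a b) (hA : ∀ t i j, A t i j = - A t j i)
    (hh : ∀ t ∈ Ioo a b, ∀ i j, HasDerivAt (fun s => h s i j)
      (∑ k, A t i k * h t k j + ∑ k, A t j k * h t i k) t)
    (h0 : ∀ i j, h t₀ i j = if i = j then 1 else 0) :
    ∀ t ∈ Ioo a b, ∀ i j, h t i j = if i = j then 1 else 0 := by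
  -- The identity is a stationary point of the Gram equation by antisymmetry, so the deviation `d`
  -- satisfies the same linear equation.
  let d : ℝ → Fin m → Fin m → ℝ := fun t i j => h t i j - if i = j then 1 else 0
  have hd : ∀ t ∈ Ioo a b, ∀ i j, HasDerivAt (fun s => d s i j)
      (∑ k, A t i k * d t k j + ∑ k, A t j k * d t i k) t := by
    intro t ht i j
    refine ((hh t ht i j).sub_const _).congr_deriv ?_
    simp only [d, mul_sub, Finset.sum_sub_distrib, mul_ite, mul_one, mul_zero,
      Finset.sum_ite_eq, Finset.sum_ite_eq', Finset.mem_univ, if_true]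
    rw [hA t j i]
    ring
  -- The squared Frobenius norm of the deviation is conserved, so no Gronwall estimate is needed.
  let e : ℝ → ℝ := fun t => ∑ i, ∑ j, d t i j ^ 2
  have he : ∀ t ∈ Ioo a b, HasDerivAt e 0 t := by
    intro t ht
    have h1 : HasDerivAt e (∑ i, ∑ j, 2 * d t i j *
        (∑ k, A t i k * d t k j + ∑ k, A t j k * d t i k)) t := by
      refine HasDerivAt.fun_sum fun i _ => HasDerivAt.fun_sum fun j _ => ?_
      simpa using (hd t ht i j).fun_pow 2
    refine h1.congr_deriv ?_
    -- An antisymmetric matrix contracted with the symmetric `B Bᵀ` gives zero. It is used for `d`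
    -- and for its transpose.
    have s1 : ∀ B : Fin m → Fin m → ℝ,
        ∑ i, ∑ k, A t i k * (∑ j, B i j * B k j) = 0 := by
      intro B
      have : ∑ i, ∑ k, A t i k * (∑ j, B i j * B k j) =
          - ∑ i, ∑ k, A t i k * (∑ j, B i j * B k j) := by
        conv_lhs => rw [Finset.sum_comm]
        rw [← Finset.sum_neg_distrib]
        refine Finset.sum_congr rfl fun i _ => ?_
        rw [← Finset.sum_neg_distrib]
        refine Finset.sum_congr rfl fun k _ => ?_
        rw [hA t k i, neg_mul]
        simp only [mul_comm]
      linarith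
    have e1 : ∑ i, ∑ j, 2 * d t i j * (∑ k, A t i k * d t k j) = 0 := by
      have := s1 (d t)
      calc _ = 2 * ∑ i, ∑ k, A t i k * (∑ j, d t i j * d t k j) := by
            simp only [Finset.mul_sum]
            refine Finset.sum_congr rfl fun i _ => ?_
            rw [Finset.sum_comm]
            refine Finset.sum_congr rfl fun k _ => Finset.sum_congr rfl fun j _ => by ring
        _ = 0 := by rw [this, mul_zero]
    have e2 : ∑ i, ∑ j, 2 * d t i j * (∑ k, A t j k * d t i k) = 0 := by
      have := s1 (fun i j => d t j i)
      calc _ = 2 * ∑ i, ∑ k, A t i k * (∑ j, d t j i * d t j k) := by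
            simp only [Finset.mul_sum]
            rw [Finset.sum_comm]
            refine Finset.sum_congr rfl fun i _ => ?_
            rw [Finset.sum_comm]
            refine Finset.sum_congr rfl fun k _ => Finset.sum_congr rfl fun j _ => by ring
        _ = 0 := by rw [this, mul_zero]
    simp only [mul_add, Finset.sum_add_distrib, e1, e2, add_zero]
  have hconst : ∀ t ∈ Ioo a b, e t = 0 := by
    have := isOpen_Ioo.eqOn_of_deriv_eq (f := e) (g := fun _ : ℝ => (0 : ℝ)) isPreconnected_Ioo
      (fun t ht => (he t ht).differentiableAt.differentiableWithinAt) (differentiableOn_const _)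
      (fun t ht => by rw [(he t ht).deriv]; simp) ht₀ (by simp [e, d, h0])
    exact this
  intro t ht i j
  have h1 := (Finset.sum_eq_zero_iff_of_nonneg fun i _ =>
    Finset.sum_nonneg fun j _ => sq_nonneg (d t i j)).1 (hconst t ht) i (Finset.mem_univ i)
  have h2 := (Finset.sum_eq_zero_iff_of_nonneg fun j _ => sq_nonneg (d t i j)).1 h1 j
    (Finset.mem_univ j)
  have h3 : d t i j = 0 := by simpa using h2
  exact sub_eq_zero.1 h3

end ODE

/-! ### The Frenet matrix -/

/-- The coefficient matrix of the Frenet formulas. -/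
def frenetMatrix {m : ℕ} [NeZero m] (κ : Fin m → ℝ → ℝ) (t : ℝ) (i k : Fin m) : ℝ :=
  if (k : ℕ) = i + 1 then κ 0 t * κ k t else if (i : ℕ) = k + 1 then -(κ 0 t * κ i t) else 0

lemma frenetMatrix_antisymm {m : ℕ} [NeZero m] (κ : Fin m → ℝ → ℝ) (t : ℝ) (i k : Fin m) :
    frenetMatrix κ t i k = - frenetMatrix κ t k i := by
  unfold frenetMatrix
  split_ifs <;> first | omega | simp

lemma contDiffOn_frenetMatrix {m : ℕ} [NeZero m] {κ : Fin m → ℝ → ℝ} {s : Set ℝ}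
    (hκ : ∀ j, ContDiffOn ℝ ∞ (κ j) s) (i k : Fin m) :
    ContDiffOn ℝ ∞ (fun t => frenetMatrix κ t i k) s := by
  unfold frenetMatrix
  split_ifs
  · exact (hκ 0).mul (hκ k)
  · exact ((hκ 0).mul (hκ i)).neg
  · exact contDiffOn_const

lemma sum_frenetMatrix_smul {m : ℕ} [NeZero m] {V : Type*} [AddCommGroup V] [Module ℝ V]
    (κ : Fin m → ℝ → ℝ) (t : ℝ) (X : Fin m → V) (i : Fin m) :
    ∑ k, frenetMatrix κ t i k • X k = κ 0 t •
    ((if h : (i : ℕ) + 1 < m then κ ⟨i + 1, h⟩ t • X ⟨i + 1, h⟩ else 0) -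
      (if 0 < (i : ℕ) then κ i t • X ⟨i - 1, (Nat.sub_le _ _).trans_lt i.isLt⟩ else 0)) := by
  have h1 : ∀ k, frenetMatrix κ t i k • X k =
      (if (k : ℕ) = i + 1 then (κ 0 t * κ k t) • X k else 0) -
      (if (i : ℕ) = k + 1 then (κ 0 t * κ i t) • X k else 0) := by
    intro k
    unfold frenetMatrix
    split_ifs <;> first | omega | simp
  simp only [h1, Finset.sum_sub_distrib, smul_sub]
  congr 1
  · split_ifs with h
    · rw [Finset.sum_eq_single ⟨i + 1, h⟩]
      · simp [mul_smul]
      · intro b _ hb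
        rw [if_neg]
        exact fun h' => hb (Fin.ext h')
      · simp
    · rw [smul_zero]
      refine Finset.sum_eq_zero fun k _ => if_neg ?_
      have := k.isLt
      omega
  · split_ifs with h
    · rw [Finset.sum_eq_single ⟨i - 1, (Nat.sub_le _ _).trans_lt i.isLt⟩]
      · rw [if_pos, mul_smul]
        simp only
        omega
      · intro b _ hb
        rw [if_neg]
        intro h'
        apply hb
        ext
        simp only
        omega
      · simp
    · rw [smul_zero]
      refine Finset.sum_eq_zero fun k _ => if_neg ?_
      omega

variable {m : ℕ} {M : Type*} [TopologicalSpace M] [ChartedSpace (EuclideanSpace ℝ (Fin m)) M]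
  [IsManifold (𝓡 m) ∞ M]

lemma christoffel_eq (g : Metric m M) (x : M) (y u v : EuclideanSpace ℝ (Fin m)) :
    christoffel g x y u v = christoffelOf (metricInChart g x) y u v := rfl

/-! ### Tangent vectors in charts -/

lemma mem_baseSet_iff {p q : M} :
    q ∈ (tangentTriv m p).baseSet ↔ q ∈ (extChartAt (𝓡 m) p).source := by
  rw [extChartAt_source, TangentBundle.trivializationAt_baseSet]

/-- The components of a tangent vector at `q` in the chart at `p`. -/
def coord (p q : M) : TangentSpace (𝓡 m) q →L[ℝ] EuclideanSpace ℝ (Fin m) :=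
  (tangentTriv m p).continuousLinearMapAt ℝ q

/-- The tangent vector at `q` with given components in the chart at `p`. -/
def coordSymm (p q : M) : EuclideanSpace ℝ (Fin m) →L[ℝ] TangentSpace (𝓡 m) q :=
  (tangentTriv m p).symmL ℝ q

lemma coord_coordSymm {p q : M} (h : q ∈ (extChartAt (𝓡 m) p).source)
    (u : EuclideanSpace ℝ (Fin m)) : coord p q (coordSymm p q u) = u :=
  (tangentTriv m p).continuousLinearMapAt_symmL (mem_baseSet_iff.2 h) u

lemma coordSymm_coord {p q : M} (h : q ∈ (extChartAt (𝓡 m) p).source)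
    (u : TangentSpace (𝓡 m) q) : coordSymm p q (coord p q u) = u :=
  (tangentTriv m p).symmL_continuousLinearMapAt (mem_baseSet_iff.2 h) u

lemma coord_injective {p q : M} (h : q ∈ (extChartAt (𝓡 m) p).source) :
    Function.Injective (coord (m := m) p q) :=
  Function.LeftInverse.injective (coordSymm_coord h)

lemma coord_eq_triv {p q : M} (h : q ∈ (extChartAt (𝓡 m) p).source)
    (u : TangentSpace (𝓡 m) q) :
    (tangentTriv m p (⟨q, u⟩ : TangentBundle (𝓡 m) M)).2 = coord p q u :=
  ((tangentTriv m p).continuousLinearMapAt_apply_of_mem ℝ (mem_baseSet_iff.2 h) u).symm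

lemma components_eq {p : M} {σ : ℝ → M} {t : ℝ} (h : σ t ∈ (extChartAt (𝓡 m) p).source)
    (V : ∀ t, TangentSpace (𝓡 m) (σ t)) : components p σ V t = coord p (σ t) (V t) :=
  coord_eq_triv h _

/-- The coordinate change from the chart at `p` to the chart at `q`. -/
def transition (m : ℕ) {M : Type*} [TopologicalSpace M]
    [ChartedSpace (EuclideanSpace ℝ (Fin m)) M] (p q : M) :
    EuclideanSpace ℝ (Fin m) → EuclideanSpace ℝ (Fin m) :=
  extChartAt (𝓡 m) q ∘ (extChartAt (𝓡 m) p).symm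

lemma contDiffAt_transition {p q z : M} (hp : z ∈ (extChartAt (𝓡 m) p).source)
    (hq : z ∈ (extChartAt (𝓡 m) q).source) :
    ContDiffAt ℝ ∞ (transition m p q) (extChartAt (𝓡 m) p z) := by
  have h := contDiffWithinAt_ext_coord_change (I := 𝓡 m) (n := ∞) q p
    (y := extChartAt (𝓡 m) p z) (by
      rw [PartialEquiv.trans_source, PartialEquiv.symm_source]
      refine ⟨(extChartAt (𝓡 m) p).map_source hp, ?_⟩
      rwa [mem_preimage, (extChartAt (𝓡 m) p).left_inv hp])
  rwa [ModelWithCorners.Boundaryless.range_eq_univ, contDiffWithinAt_univ] at h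

omit [IsManifold (𝓡 m) ∞ M] in
lemma transition_apply {p q z : M} (hp : z ∈ (extChartAt (𝓡 m) p).source) :
    transition m p q (extChartAt (𝓡 m) p z) = extChartAt (𝓡 m) q z := by
  rw [transition, Function.comp_apply, (extChartAt (𝓡 m) p).left_inv hp]

lemma coord_eq_mfderiv {p z : M} (hp : z ∈ (extChartAt (𝓡 m) p).source) :
    coord p z = mfderiv (𝓡 m) 𝓘(ℝ, EuclideanSpace ℝ (Fin m)) (extChartAt (𝓡 m) p) z :=
  TangentBundle.continuousLinearMapAt_trivializationAt (by simpa using hp)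

lemma coord_change {p q z : M} (hp : z ∈ (extChartAt (𝓡 m) p).source)
    (hq : z ∈ (extChartAt (𝓡 m) q).source) (u : TangentSpace (𝓡 m) z) :
    coord q z u = fderiv ℝ (transition m p q) (extChartAt (𝓡 m) p z) (coord p z u) := by
  have hev : extChartAt (𝓡 m) q =ᶠ[𝓝 z] transition m p q ∘ extChartAt (𝓡 m) p := by
    filter_upwards [(isOpen_extChartAt_source (I := 𝓡 m) p).mem_nhds hp] with w hw
    exact (transition_apply hw).symm
  rw [coord_eq_mfderiv hq, coord_eq_mfderiv hp, hev.mfderiv_eq,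
    mfderiv_comp (I' := 𝓘(ℝ, EuclideanSpace ℝ (Fin m))) z, mfderiv_eq_fderiv]
  · rfl
  · exact ((contDiffAt_transition hp hq).differentiableAt (by simp)).mdifferentiableAt
  · exact mdifferentiableAt_extChartAt (by simpa using hp)

/-- By `coord_change` the differential of the transition map is the passage from components in one
chart to components in the other, which is reversible. -/
lemma surjective_fderiv_transition {p q z : M} (hp : z ∈ (extChartAt (𝓡 m) p).source)
    (hq : z ∈ (extChartAt (𝓡 m) q).source) :
    Function.Surjective (fderiv ℝ (transition m p q) (extChartAt (𝓡 m) p z)) := fun u =>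
  ⟨coord p z (coordSymm q z u), by rw [← coord_change hp hq, coord_coordSymm hq]⟩

/-! ### The metric in charts -/

lemma metricInChart_eq (g : Metric m M) {p z : M} (hp : z ∈ (extChartAt (𝓡 m) p).source)
    (u v : EuclideanSpace ℝ (Fin m)) :
    metricInChart g p (extChartAt (𝓡 m) p z) u v =
      g.inner z (coordSymm p z u) (coordSymm p z v) := by
  rw [metricInChart_apply, (extChartAt (𝓡 m) p).left_inv hp]
  rfl

lemma metricInChart_coord (g : Metric m M) {p z : M} (hp : z ∈ (extChartAt (𝓡 m) p).source)
    (u v : TangentSpace (𝓡 m) z) :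
    metricInChart g p (extChartAt (𝓡 m) p z) (coord p z u) (coord p z v) = g.inner z u v := by
  rw [metricInChart_eq g hp, coordSymm_coord hp, coordSymm_coord hp]

lemma metricInChart_symm (g : Metric m M) (p : M) (y u v : EuclideanSpace ℝ (Fin m)) :
    metricInChart g p y u v = metricInChart g p y v u := by
  rw [metricInChart_apply, metricInChart_apply, g.symm]

lemma isInvertible_metricInChart (g : Metric m M) {p z : M}
    (hp : z ∈ (extChartAt (𝓡 m) p).source) :
    (metricInChart g p (extChartAt (𝓡 m) p z)).IsInvertible := by
  refine isInvertible_of_pos fun v hv => ?_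
  rw [metricInChart_eq g hp]
  refine g.pos _ _ fun h => hv ?_
  rw [← coord_coordSymm hp v, h, map_zero]

lemma contMDiffAt_mk_coordSymm {p z : M} (hp : z ∈ (extChartAt (𝓡 m) p).source)
    (u : EuclideanSpace ℝ (Fin m)) :
    ContMDiffAt (𝓡 m) (𝓡 m).tangent ∞
      (fun w => (⟨w, coordSymm p w u⟩ : TangentBundle (𝓡 m) M)) z := by
  refine ((tangentTriv m p).contMDiffAt_section_iff (mem_baseSet_iff.2 hp)).2 ?_
  refine (contMDiffAt_const (c := u)).congr_of_eventuallyEq ?_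
  filter_upwards [(isOpen_extChartAt_source (I := 𝓡 m) p).mem_nhds hp] with w hw
  rw [coord_eq_triv hw, coord_coordSymm hw]

/-- The components of the metric are its values on the coordinate fields, which are smooth sections
by `contMDiffAt_mk_coordSymm`. -/
lemma contDiffAt_metricInChart (g : Metric m M) {p z : M}
    (hp : z ∈ (extChartAt (𝓡 m) p).source) :
    ContDiffAt ℝ ∞ (metricInChart g p) (extChartAt (𝓡 m) p z) := by
  have hopen : IsOpen (extChartAt (𝓡 m) p).target := isOpen_extChartAt_target p
  have hz : extChartAt (𝓡 m) p z ∈ (extChartAt (𝓡 m) p).target :=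
    (extChartAt (𝓡 m) p).map_source hp
  suffices h : ContDiffOn ℝ ∞ (metricInChart g p) (extChartAt (𝓡 m) p).target from
    h.contDiffAt (hopen.mem_nhds hz)
  rw [contDiffOn_clm_apply]
  intro u
  rw [contDiffOn_clm_apply]
  intro v y hy
  refine ContDiffAt.contDiffWithinAt ?_
  have hw : (extChartAt (𝓡 m) p).symm y ∈ (extChartAt (𝓡 m) p).source :=
    (extChartAt (𝓡 m) p).map_target hy
  have h1 := (g.contMDiff ((extChartAt (𝓡 m) p).symm y)).clm_bundle_apply₂
    (F₃ := ℝ) (E₃ := fun _ : M => ℝ)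
    (contMDiffAt_mk_coordSymm hw u) (contMDiffAt_mk_coordSymm hw v)
  have h2 := (contMDiffAt_totalSpace.1 h1).2
  have h3 : ContMDiffAt (𝓡 m) 𝓘(ℝ, ℝ) ∞
      (fun w => g.inner w (coordSymm p w u) (coordSymm p w v)) ((extChartAt (𝓡 m) p).symm y) :=
    h2
  have h4 := (contMDiffOn_extChartAt_symm (I := 𝓡 m) (n := ∞) p).contMDiffAt
    (hopen.mem_nhds hy)
  exact (h3.comp y h4).contDiffAt

lemma metricInChart_transform (g : Metric m M) {p q z : M}
    (hp : z ∈ (extChartAt (𝓡 m) p).source) (hq : z ∈ (extChartAt (𝓡 m) q).source) :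
    ∀ᶠ y in 𝓝 (extChartAt (𝓡 m) p z), ∀ a b, metricInChart g p y a b =
      metricInChart g q (transition m p q y) (fderiv ℝ (transition m p q) y a)
        (fderiv ℝ (transition m p q) y b) := by
  have hz : extChartAt (𝓡 m) p z ∈ (extChartAt (𝓡 m) p).target :=
    (extChartAt (𝓡 m) p).map_source hp
  have hc : ContinuousAt (extChartAt (𝓡 m) p).symm (extChartAt (𝓡 m) p z) :=
    continuousAt_extChartAt_symm' hp
  have hq' : (extChartAt (𝓡 m) q).source ∈ 𝓝 ((extChartAt (𝓡 m) p).symm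
      (extChartAt (𝓡 m) p z)) := by
    rw [(extChartAt (𝓡 m) p).left_inv hp]
    exact (isOpen_extChartAt_source (I := 𝓡 m) q).mem_nhds hq
  filter_upwards [hc.eventually_mem hq', (isOpen_extChartAt_target p).mem_nhds hz]
    with y hyq hyt a b
  have hyp : (extChartAt (𝓡 m) p).symm y ∈ (extChartAt (𝓡 m) p).source :=
    (extChartAt (𝓡 m) p).map_target hyt
  obtain ⟨w, hwp, hwq, rfl⟩ : ∃ w, w ∈ (extChartAt (𝓡 m) p).source ∧
      w ∈ (extChartAt (𝓡 m) q).source ∧ extChartAt (𝓡 m) p w = y :=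
    ⟨_, hyp, hyq, (extChartAt (𝓡 m) p).right_inv hyt⟩
  have e1 := coord_change hwp hwq (coordSymm p w a)
  have e2 := coord_change hwp hwq (coordSymm p w b)
  rw [coord_coordSymm hwp] at e1 e2
  rw [← e1, ← e2, transition_apply hwp, metricInChart_coord g hwq, metricInChart_eq g hwp]

lemma christoffel_transform (g : Metric m M) {p q z : M}
    (hp : z ∈ (extChartAt (𝓡 m) p).source) (hq : z ∈ (extChartAt (𝓡 m) q).source)
    (u v : EuclideanSpace ℝ (Fin m)) :
    fderiv ℝ (transition m p q) (extChartAt (𝓡 m) p z)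
      (christoffel g p (extChartAt (𝓡 m) p z) u v) =
      christoffel g q (extChartAt (𝓡 m) q z)
        (fderiv ℝ (transition m p q) (extChartAt (𝓡 m) p z) u)
        (fderiv ℝ (transition m p q) (extChartAt (𝓡 m) p z) v) +
      fderiv ℝ (fderiv ℝ (transition m p q)) (extChartAt (𝓡 m) p z) u v := by
  have ht := transition_apply (m := m) (q := q) hp
  simp only [christoffel_eq]
  rw [← ht]
  refine christoffelOf_transform ((contDiffAt_transition hp hq).of_le (by norm_cast))
    (surjective_fderiv_transition hp hq) ?_ (isInvertible_metricInChart g hp) ?_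
    (Eventually.of_forall fun y a b => metricInChart_symm g q y a b)
    (metricInChart_transform g hp hq) u v
    ((contDiffAt_metricInChart g hp).differentiableAt (by simp))
  · rw [ht]
    exact (contDiffAt_metricInChart g hq).differentiableAt (by simp)
  · rw [ht]
    exact isInvertible_metricInChart g hq

lemma contDiffAt_christoffel (g : Metric m M) {p z : M}
    (hp : z ∈ (extChartAt (𝓡 m) p).source) (u v : EuclideanSpace ℝ (Fin m)) :
    ContDiffAt ℝ ∞ (fun w : EuclideanSpace ℝ (Fin m) × EuclideanSpace ℝ (Fin m) ×
      EuclideanSpace ℝ (Fin m) => christoffel g p w.1 w.2.1 w.2.2)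
      (extChartAt (𝓡 m) p z, u, v) :=
  contDiffAt_christoffelOf (contDiffAt_metricInChart g hp) (isInvertible_metricInChart g hp) u v

/-! ### Covariant derivatives in charts -/

/-- A curve read in the chart at `p`. -/
def curveInChart (m : ℕ) {M : Type*} [TopologicalSpace M]
    [ChartedSpace (EuclideanSpace ℝ (Fin m)) M] (p : M) (σ : ℝ → M) (t : ℝ) :
    EuclideanSpace ℝ (Fin m) :=
  extChartAt (𝓡 m) p (σ t)

lemma hasDerivAt_curveInChart {p : M} {σ : ℝ → M} {t : ℝ}
    (hσ : MDifferentiableAt 𝓘(ℝ, ℝ) (𝓡 m) σ t) (hp : σ t ∈ (extChartAt (𝓡 m) p).source) :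
    HasDerivAt (curveInChart m p σ) (components p σ (velocity σ) t) t := by
  have h1 : HasMFDerivAt (𝓡 m) 𝓘(ℝ, EuclideanSpace ℝ (Fin m)) (extChartAt (𝓡 m) p) (σ t)
      (coord p (σ t)) := by
    rw [coord_eq_mfderiv hp]
    exact (mdifferentiableAt_extChartAt (by simpa using hp)).hasMFDerivAt
  let L : ℝ →L[ℝ] EuclideanSpace ℝ (Fin m) :=
    (coord p (σ t)).comp (mfderiv 𝓘(ℝ, ℝ) (𝓡 m) σ t)
  have h2 : HasFDerivAt (curveInChart m p σ) L t := (h1.comp t hσ.hasMFDerivAt).hasFDerivAt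
  rw [components_eq hp]
  exact h2.hasDerivAt

omit [IsManifold (𝓡 m) ∞ M] in
lemma eventually_mem_source {p : M} {σ : ℝ → M} {t : ℝ} (hσ : ContinuousAt σ t)
    (hp : σ t ∈ (extChartAt (𝓡 m) p).source) :
    ∀ᶠ s in 𝓝 t, σ s ∈ (extChartAt (𝓡 m) p).source :=
  hσ.eventually_mem ((isOpen_extChartAt_source (I := 𝓡 m) p).mem_nhds hp)

/-- The second-derivative term is the failure of the plain derivative to be tensorial; it cancels
against the one in `christoffel_transform`. -/
lemma hasDerivAt_components_change {p q : M} {σ : ℝ → M} {t : ℝ}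
    (hσ : MDifferentiableAt 𝓘(ℝ, ℝ) (𝓡 m) σ t) (hp : σ t ∈ (extChartAt (𝓡 m) p).source)
    (hq : σ t ∈ (extChartAt (𝓡 m) q).source) {V : ∀ t, TangentSpace (𝓡 m) (σ t)}
    (hV : DifferentiableAt ℝ (components p σ V) t) :
    HasDerivAt (components q σ V)
      (fderiv ℝ (fderiv ℝ (transition m p q)) (extChartAt (𝓡 m) p (σ t))
        (components p σ (velocity σ) t) (components p σ V t) +
      fderiv ℝ (transition m p q) (extChartAt (𝓡 m) p (σ t)) (deriv (components p σ V) t)) t := by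
  have hD : DifferentiableAt ℝ (fderiv ℝ (transition m p q)) (extChartAt (𝓡 m) p (σ t)) :=
    ((contDiffAt_transition hp hq).fderiv_right (m := 1) (by
      norm_cast)).differentiableAt one_ne_zero
  have h1 := (hD.hasFDerivAt.comp_hasDerivAt t (hasDerivAt_curveInChart hσ hp)).clm_apply
    hV.hasDerivAt
  refine h1.congr_of_eventuallyEq ?_
  filter_upwards [eventually_mem_source hσ.continuousAt hp,
    eventually_mem_source hσ.continuousAt hq] with s h1 h2
  rw [components_eq h2, coord_change h1 h2, components_eq h1]
  rfl

/-- The coordinate expression of the covariant derivative is valid in every chart. -/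
lemma coord_covDerivAlong (g : Metric m M) {p : M} {σ : ℝ → M} {t : ℝ}
    (hσ : MDifferentiableAt 𝓘(ℝ, ℝ) (𝓡 m) σ t) (hp : σ t ∈ (extChartAt (𝓡 m) p).source)
    {V : ∀ t, TangentSpace (𝓡 m) (σ t)} (hV : DifferentiableAt ℝ (components p σ V) t) :
    coord p (σ t) (covDerivAlong g σ V t) = deriv (components p σ V) t +
      christoffel g p (extChartAt (𝓡 m) p (σ t)) (components p σ (velocity σ) t)
        (components p σ V t) := by
  have hq : σ t ∈ (extChartAt (𝓡 m) (σ t)).source := mem_extChartAt_source _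
  -- The differential of the transition map is injective, so the identity may be checked in the
  -- chart at `σ t`, where `covDerivAlong` is defined.
  have hinj : ∀ a b : EuclideanSpace ℝ (Fin m),
      fderiv ℝ (transition m p (σ t)) (extChartAt (𝓡 m) p (σ t)) a =
      fderiv ℝ (transition m p (σ t)) (extChartAt (𝓡 m) p (σ t)) b → a = b := by
    intro a b hab
    rw [← coord_coordSymm hp a, ← coord_coordSymm hp b] at hab ⊢
    rw [← coord_change hp hq, ← coord_change hp hq] at hab
    rw [coord_injective hq hab]
  apply hinj
  rw [← coord_change hp hq, map_add, christoffel_transform g hp hq,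
    components_eq hp, components_eq hp, ← coord_change hp hq, ← coord_change hp hq]
  have h := (hasDerivAt_components_change hσ hp hq hV).deriv
  have : coord (σ t) (σ t) (covDerivAlong g σ V t) = deriv (components (σ t) σ V) t +
      christoffel g (σ t) (extChartAt (𝓡 m) (σ t) (σ t)) (components (σ t) σ (velocity σ) t)
        (components (σ t) σ V t) := coord_coordSymm hq _
  rw [this, h, components_eq hq, components_eq hq, components_eq hp, components_eq hp]
  abel

/-! ### Smooth fields along curves -/

lemma contMDiffAt_field_iff {p : M} {σ : ℝ → M} {t : ℝ} {V : ∀ t, TangentSpace (𝓡 m) (σ t)}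
    (hp : σ t ∈ (extChartAt (𝓡 m) p).source) :
    ContMDiffAt 𝓘(ℝ, ℝ) (𝓡 m).tangent ∞ (fun t => (⟨σ t, V t⟩ : TangentBundle (𝓡 m) M)) t ↔
      ContMDiffAt 𝓘(ℝ, ℝ) (𝓡 m) ∞ σ t ∧ ContDiffAt ℝ ∞ (components p σ V) t := by
  rw [(tangentTriv m p).contMDiffAt_iff
    (f := fun t => (⟨σ t, V t⟩ : TangentBundle (𝓡 m) M)) (x₀ := t)
    ((tangentTriv m p).mem_source.2 (mem_baseSet_iff.2 hp))]
  exact and_congr_right fun _ => contMDiffAt_iff_contDiffAt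

/-- Linearity in the last slot holds at every `y`, even where the form is not invertible, since
`inverse` is always a linear map. -/
lemma exists_christoffel_eq (g : Metric m M) (x : M) (y u : EuclideanSpace ℝ (Fin m)) :
    ∃ L : EuclideanSpace ℝ (Fin m) →ₗ[ℝ] EuclideanSpace ℝ (Fin m),
      ∀ v, christoffel g x y u v = L v := by
  refine ⟨⟨⟨christoffel g x y u, fun a b => ?_⟩, fun c a => ?_⟩, fun v => rfl⟩
  · simp only [christoffel]
    rw [← map_add]
    congr 1
    simp only [map_add, _root_.add_apply]
    module
  · simp only [christoffel, RingHom.id_apply]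
    rw [← map_smul]
    congr 1
    simp only [map_smul, _root_.smul_apply]
    module

/-- The Leibniz rule for the covariant derivative of a linear combination of fields. -/
lemma covDerivAlong_sum (g : Metric m M) {σ : ℝ → M} {t : ℝ} (hσ : ContinuousAt σ t) {n : ℕ}
    {V : ∀ t, TangentSpace (𝓡 m) (σ t)} {X : Fin n → ∀ t, TangentSpace (𝓡 m) (σ t)}
    {c : ℝ → Fin n → ℝ} (hV : ∀ᶠ s in 𝓝 t, V s = ∑ j, c s j • X j s)
    (hc : ∀ j, DifferentiableAt ℝ (fun s => c s j) t)
    (hX : ∀ j, DifferentiableAt ℝ (components (σ t) σ (X j)) t) :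
    covDerivAlong g σ V t =
      ∑ j, (deriv (fun s => c s j) t • X j t + c t j • covDerivAlong g σ (X j) t) := by
  have hq : σ t ∈ (extChartAt (𝓡 m) (σ t)).source := mem_extChartAt_source _
  have hev : components (σ t) σ V =ᶠ[𝓝 t] fun s => ∑ j, c s j • components (σ t) σ (X j) s := by
    filter_upwards [hV, eventually_mem_source hσ hq] with s hs hsq
    rw [components_eq hsq, hs, map_sum]
    exact Finset.sum_congr rfl fun j _ => by rw [map_smul, components_eq hsq]
  have hd : HasDerivAt (fun s => ∑ j, c s j • components (σ t) σ (X j) s)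
      (∑ j, (c t j • deriv (components (σ t) σ (X j)) t +
        deriv (fun s => c s j) t • components (σ t) σ (X j) t)) t :=
    HasDerivAt.fun_sum fun j _ => (hc j).hasDerivAt.smul (hX j).hasDerivAt
  obtain ⟨L, hL⟩ := exists_christoffel_eq g (σ t) (extChartAt (𝓡 m) (σ t) (σ t))
    (components (σ t) σ (velocity σ) t)
  have hcov : ∀ W : ∀ t, TangentSpace (𝓡 m) (σ t), covDerivAlong g σ W t =
      coordSymm (σ t) (σ t) (deriv (components (σ t) σ W) t + L (components (σ t) σ W t)) :=
    fun W => by rw [← hL]; rfl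
  simp only [hcov]
  rw [hev.deriv_eq, hd.deriv, hev.self_of_nhds, map_sum, ← Finset.sum_add_distrib, map_sum]
  refine Finset.sum_congr rfl fun j _ => ?_
  conv_rhs => rw [← coordSymm_coord hq (X j t), ← components_eq hq (X j)]
  simp only [map_add, map_smul]
  module

/-! ### Osculating spaces -/

/-- The determinant is the product of the diagonal entries, and the inverse matrix recovers `v` from
`w`. -/
lemma sameSpanAndOrientation_of_lowerTriangular {V : Type*} [AddCommGroup V] [Module ℝ V] {k : ℕ}
    {v w : Fin k → V} (A : Matrix (Fin k) (Fin k) ℝ) (hA : ∀ i j, i < j → A i j = 0)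
    (hd : ∀ i, 0 < A i i) (hw : ∀ i, w i = ∑ j, A i j • v j) : SameSpanAndOrientation v w := by
  have hdet : 0 < A.det := by
    rw [Matrix.det_of_isLowerTriangular A fun i j hij => hA i j hij]
    exact Finset.prod_pos fun i _ => hd i
  refine ⟨le_antisymm ?_ ?_, A, hdet, hw⟩
  · rw [Submodule.span_le]
    rintro _ ⟨i, rfl⟩
    have hinv : A⁻¹ * A = 1 := Matrix.nonsing_inv_mul A (isUnit_iff_ne_zero.2 hdet.ne')
    have : v i = ∑ j, A⁻¹ i j • w j := by
      simp only [hw, Finset.smul_sum, smul_smul]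
      rw [Finset.sum_comm]
      simp only [← Finset.sum_smul, ← Matrix.mul_apply, hinv, Matrix.one_apply, ite_smul,
        one_smul, zero_smul, Finset.sum_ite_eq, Finset.mem_univ, if_true]
    rw [this]
    exact Submodule.sum_mem _ fun j _ => Submodule.smul_mem _ _ (Submodule.subset_span ⟨j, rfl⟩)
  · rw [Submodule.span_le]
    rintro _ ⟨i, rfl⟩
    rw [hw]
    exact Submodule.sum_mem _ fun j _ => Submodule.smul_mem _ _ (Submodule.subset_span ⟨j, rfl⟩)

lemma SameSpanAndOrientation.linearIndependent {V : Type*} [AddCommGroup V] [Module ℝ V] {k : ℕ}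
    {v w : Fin k → V} (h : SameSpanAndOrientation v w) (hv : LinearIndependent ℝ v) :
    LinearIndependent ℝ w := by
  rw [linearIndependent_iff_card_eq_finrank_span] at hv ⊢
  rw [hv, Set.finrank, Set.finrank, h.1]

/-- The iterated covariant derivatives of the velocity of a curve satisfying the Frenet equations
are triangular combinations of the frame. -/
lemma exists_iterCovDeriv_eq [NeZero m] (g : Metric m M) {σ : ℝ → M} {s : Set ℝ} (hs : IsOpen s)
    {X : Fin m → ∀ t, TangentSpace (𝓡 m) (σ t)} {κ : Fin m → ℝ → ℝ}
    (hX : ∀ i, ContMDiffOn 𝓘(ℝ, ℝ) (𝓡 m).tangent ∞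
      (fun t => (⟨σ t, X i t⟩ : TangentBundle (𝓡 m) M)) s)
    (hκ : ∀ j, ContDiffOn ℝ ∞ (κ j) s)
    (hpos : ∀ j : Fin m, (j : ℕ) + 1 < m → ∀ t ∈ s, 0 < κ j t)
    (hvel : ∀ t ∈ s, velocity σ t = κ 0 t • X 0 t)
    (hfr : ∀ i, ∀ t ∈ s, covDerivAlong g σ (X i) t = ∑ k, frenetMatrix κ t i k • X k t)
    (k : ℕ) (hk : k < m) :
    ∃ c : ℝ → Fin m → ℝ, (∀ j, ContDiffOn ℝ ∞ (fun t => c t j) s) ∧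
      (∀ t ∈ s, iterCovDeriv g σ k t = ∑ j, c t j • X j t) ∧
      (∀ t ∈ s, ∀ j : Fin m, k < j → c t j = 0) ∧
      (k + 1 < m → ∀ t ∈ s, 0 < c t ⟨k, hk⟩) := by
  induction k with
  | zero =>
    -- The positivity claim is restricted to `k + 1 < m` because the last curvature has no sign; for
    -- `m = 1` this already concerns `κ 0`.
    refine ⟨fun t j => if j = 0 then κ 0 t else 0, fun j => ?_, fun t ht => ?_,
      fun t _ j hj => ?_, fun h t ht => ?_⟩
    · by_cases hj : j = 0
      · simpa [hj] using hκ 0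
      · simpa [hj] using contDiffOn_const
    · simp only [ite_smul, zero_smul, Finset.sum_ite_eq', Finset.mem_univ, if_true]
      exact hvel t ht
    · refine if_neg ?_
      rintro rfl
      simp at hj
    · have h0 : (⟨0, hk⟩ : Fin m) = 0 := rfl
      simpa [h0] using hpos 0 (by simpa using h) t ht
  | succ k ih =>
    obtain ⟨c, hc, hit, hzero, hcpos⟩ := ih (by omega)
    -- Leibniz rule: the coefficient row evolves by `c ↦ c' + c A` with `A` the Frenet matrix.
    refine ⟨fun t j => deriv (fun r => c r j) t + ∑ i, c t i * frenetMatrix κ t i j,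
      fun j => ?_, fun t ht => ?_, fun t ht j hj => ?_, fun h t ht => ?_⟩
    · refine ((hc j).deriv_of_isOpen hs (by simp)).add ?_
      exact ContDiffOn.sum fun i _ => (hc i).mul (contDiffOn_frenetMatrix hκ i j)
    · have hXt : ∀ j, ContMDiffAt 𝓘(ℝ, ℝ) (𝓡 m) ∞ σ t ∧
          ContDiffAt ℝ ∞ (components (σ t) σ (X j)) t := fun j =>
        (contMDiffAt_field_iff (mem_extChartAt_source _)).1 ((hX j).contMDiffAt (hs.mem_nhds ht))
      have h1 : iterCovDeriv g σ (k + 1) t = covDerivAlong g σ (iterCovDeriv g σ k) t := by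
        rw [iterCovDeriv, Function.iterate_succ_apply']
        rfl
      rw [h1, covDerivAlong_sum g (hXt 0).1.continuousAt
        (eventually_of_mem (hs.mem_nhds ht) hit)
        (fun j => ((hc j).contDiffAt (hs.mem_nhds ht)).differentiableAt (by simp))
        (fun j => (hXt j).2.differentiableAt (by simp))]
      simp only [hfr _ t ht, add_smul, Finset.sum_add_distrib, Finset.smul_sum, Finset.sum_smul,
        smul_smul]
      congr 1
      exact Finset.sum_comm
    · have hd : deriv (fun r => c r j) t = 0 := by
        have : (fun r => c r j) =ᶠ[𝓝 t] fun _ => 0 :=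
          eventually_of_mem (hs.mem_nhds ht) fun r hr => hzero r hr j (by omega)
        rw [this.deriv_eq, deriv_const]
      beta_reduce
      rw [hd, zero_add]
      refine Finset.sum_eq_zero fun i _ => ?_
      by_cases hi : k < (i : ℕ)
      · rw [hzero t ht i hi, zero_mul]
      · have : frenetMatrix κ t i j = 0 := by
          unfold frenetMatrix
          rw [if_neg (by omega), if_neg (by omega)]
        rw [this, mul_zero]
    · have hd : deriv (fun r => c r ⟨k + 1, hk⟩) t = 0 := by
        have : (fun r => c r ⟨k + 1, hk⟩) =ᶠ[𝓝 t] fun _ => 0 :=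
          eventually_of_mem (hs.mem_nhds ht) fun r hr => hzero r hr _ (by simp)
        rw [this.deriv_eq, deriv_const]
      beta_reduce
      -- Only the superdiagonal entry reaches index `k + 1`, so the new leading coefficient is `c_k
      -- κ₀ κ_{k+1}`.
      rw [hd, zero_add, Finset.sum_eq_single ⟨k, by omega⟩]
      · have : frenetMatrix κ t ⟨k, by omega⟩ ⟨k + 1, hk⟩ = κ 0 t * κ ⟨k + 1, hk⟩ t := by
          simp [frenetMatrix]
        rw [this]
        refine mul_pos (hcpos (by omega) t ht) (mul_pos (hpos 0 ?_ t ht) (hpos _ h t ht))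
        simp only [Fin.val_zero]
        omega
      · intro i _ hi
        by_cases hi' : k < (i : ℕ)
        · rw [hzero t ht i hi', zero_mul]
        · have hne : (i : ℕ) ≠ k := fun h' => hi (Fin.ext h')
          have : frenetMatrix κ t i ⟨k + 1, hk⟩ = 0 := by
            unfold frenetMatrix
            rw [if_neg (by simp only; omega), if_neg (by simp only; omega)]
          rw [this, mul_zero]
      · simp

lemma osculating_of_frenet [NeZero m] (g : Metric m M) {σ : ℝ → M} {s : Set ℝ} (hs : IsOpen s)
    {X : Fin m → ∀ t, TangentSpace (𝓡 m) (σ t)} {κ : Fin m → ℝ → ℝ}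
    (hX : ∀ i, ContMDiffOn 𝓘(ℝ, ℝ) (𝓡 m).tangent ∞
      (fun t => (⟨σ t, X i t⟩ : TangentBundle (𝓡 m) M)) s)
    (hκ : ∀ j, ContDiffOn ℝ ∞ (κ j) s)
    (hpos : ∀ j : Fin m, (j : ℕ) + 1 < m → ∀ t ∈ s, 0 < κ j t)
    (hvel : ∀ t ∈ s, velocity σ t = κ 0 t • X 0 t)
    (hfr : ∀ i, ∀ t ∈ s, covDerivAlong g σ (X i) t = ∑ k, frenetMatrix κ t i k • X k t)
    (k : ℕ) (hk : k < m) (t : ℝ) (ht : t ∈ s) :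
    SameSpanAndOrientation (fun i : Fin k => X ⟨i, i.isLt.trans hk⟩ t)
      (fun i : Fin k => iterCovDeriv g σ i t) := by
  choose c _ hit hzero hcpos using fun i : Fin k =>
    exists_iterCovDeriv_eq g hs hX hκ hpos hvel hfr i (i.isLt.trans hk)
  refine sameSpanAndOrientation_of_lowerTriangular
    (fun i j => c i t ⟨j, j.isLt.trans hk⟩) (fun i j hij => hzero i t ht _ hij)
    (fun i => hcpos i (by omega) t ht) fun i => ?_
  rw [hit i t ht]
  symm
  -- The sum over all `m` frame vectors reduces to the first `k`, since coefficients beyond the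
  -- diagonal vanish.
  refine Finset.sum_of_injOn (fun j : Fin k => (⟨j, j.isLt.trans hk⟩ : Fin m)) ?_ (by simp) ?_
    (fun _ _ => rfl)
  · intro a _ b _ hab
    exact Fin.ext (by simpa using hab)
  · intro j _ hj
    have hkj : k ≤ (j : ℕ) := by
      by_contra hlt
      exact hj ⟨⟨j, by omega⟩, by simp, rfl⟩
    rw [hzero i t ht j (by omega), zero_smul]

/-! ### Orthonormal and oriented frames -/

lemma IsOrthonormal.linearIndependent {g : Metric m M} {x : M}
    {v : Fin m → TangentSpace (𝓡 m) x} (hv : IsOrthonormal g x v) : LinearIndependent ℝ v := by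
  rw [Fintype.linearIndependent_iff]
  intro c hc j
  have h : g.inner x (∑ i, c i • v i) (v j) = c j := by
    simp only [map_sum, map_smul, _root_.sum_apply, _root_.smul_apply, hv _ j, smul_eq_mul,
      mul_ite, mul_one, mul_zero, Finset.sum_ite_eq', Finset.mem_univ, if_true]
  rw [← h, hc]
  simp

lemma continuousAt_basis_det {E : Type*} [NormedAddCommGroup E] [NormedSpace ℝ E]
    [FiniteDimensional ℝ E] {n : ℕ} (b : Module.Basis (Fin n) ℝ E) {x : ℝ → Fin n → E} {t : ℝ}
    (hx : ∀ i, ContinuousAt (fun s => x s i) t) : ContinuousAt (fun s => b.det (x s)) t := by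
  simp only [Module.Basis.det_apply]
  have : ContinuousAt (fun s => b.toMatrix (x s)) t := by
    refine continuousAt_pi.2 fun i => continuousAt_pi.2 fun j => ?_
    exact ((b.coord i).continuous_of_finiteDimensional.continuousAt).comp (hx j)
  exact (Continuous.matrix_det continuous_id).continuousAt.comp this

/-- A continuous frame that is positively oriented at `t₀` is positively oriented near `t₀`. -/
lemma eventually_isPositivelyOriented [NeZero m] (o : ManifoldOrientation m M) {σ : ℝ → M} {t₀ : ℝ}
    (hσ : ContinuousAt σ t₀) {X : Fin m → ∀ t, TangentSpace (𝓡 m) (σ t)}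
    (hX : ∀ i, ContinuousAt (components (σ t₀) σ (X i)) t₀)
    (hpos : IsPositivelyOriented o (σ t₀) (fun i => X i t₀)) :
    ∀ᶠ t in 𝓝 t₀, LinearIndependent ℝ (fun i => X i t) →
      IsPositivelyOriented o (σ t) (fun i => X i t) := by
  obtain ⟨b, hb, hbo⟩ := hpos
  have hq : σ t₀ ∈ (extChartAt (𝓡 m) (σ t₀)).source := mem_extChartAt_source _
  let e₀ := (tangentTriv m (σ t₀)).linearEquivAt ℝ (σ t₀) (mem_baseSet_iff.2 hq)
  -- Components are compared with the initial frame in one fixed chart: the determinant is `1` at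
  -- `t₀` and continuous.
  have hdet : ∀ᶠ t in 𝓝 t₀, 0 < (b.map e₀).det (fun i => components (σ t₀) σ (X i) t) := by
    refine (continuousAt_basis_det (b.map e₀) hX).eventually (lt_mem_nhds ?_)
    have : (fun i => components (σ t₀) σ (X i) t₀) = b.map e₀ := by
      ext1 i
      rw [Module.Basis.map_apply, hb]
      rfl
    beta_reduce
    rw [this, Module.Basis.det_self]
    exact one_pos
  filter_upwards [hdet, hσ.eventually (o.locally_constant (σ t₀)), eventually_mem_source hσ hq]
    with t h1 h2 h3 hli
  have hfr : Module.finrank ℝ (TangentSpace (𝓡 m) (σ t)) = m := finrank_euclideanSpace_fin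
  have hcard : Fintype.card (Fin m) = Module.finrank ℝ (TangentSpace (𝓡 m) (σ t)) := by
    rw [hfr, Fintype.card_fin]
  let B := basisOfLinearIndependentOfCardEqFinrank hli hcard
  have hB : ∀ i, B i = X i t := fun i => by
    simp [B]
  refine ⟨B, hB, ?_⟩
  let e := (tangentTriv m (σ t₀)).linearEquivAt ℝ (σ t) (mem_baseSet_iff.2 h3)
  apply (Orientation.map (Fin m) e).injective
  rw [h2 (mem_baseSet_iff.2 h3), ← hbo, ← Module.Basis.orientation_map,
    ← Module.Basis.orientation_map, eq_comm, Module.Basis.orientation_eq_iff_det_pos]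
  have h4 : (B.map e : Fin m → EuclideanSpace ℝ (Fin m)) =
      fun i => components (σ t₀) σ (X i) t := by
    ext1 i
    rw [Module.Basis.map_apply, hB]
    rfl
  rw [h4]
  exact h1

/-! ### The Frenet system in a chart -/

/-- The right-hand side of the Frenet system in the chart at `p`: the unknowns are the coordinates
of the curve and the components of the frame. -/
def frenetField [NeZero m] (g : Metric m M) (κ : Fin m → ℝ → ℝ) (p : M)
    (w : ℝ × EuclideanSpace ℝ (Fin m) × (Fin m → EuclideanSpace ℝ (Fin m))) :
    EuclideanSpace ℝ (Fin m) × (Fin m → EuclideanSpace ℝ (Fin m)) :=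
  (κ 0 w.1 • w.2.2 0, fun i => ∑ k, frenetMatrix κ w.1 i k • w.2.2 k -
    christoffel g p w.2.1 (κ 0 w.1 • w.2.2 0) (w.2.2 i))

lemma contDiffAt_frenetField [NeZero m] (g : Metric m M) {κ : Fin m → ℝ → ℝ} {s : Set ℝ}
    (hs : IsOpen s) (hκ : ∀ j, ContDiffOn ℝ ∞ (κ j) s) {p z : M}
    (hp : z ∈ (extChartAt (𝓡 m) p).source) {t : ℝ} (ht : t ∈ s)
    (x : Fin m → EuclideanSpace ℝ (Fin m)) :
    ContDiffAt ℝ ∞ (frenetField g κ p) (t, extChartAt (𝓡 m) p z, x) := by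
  let w₀ : ℝ × EuclideanSpace ℝ (Fin m) × (Fin m → EuclideanSpace ℝ (Fin m)) :=
    (t, extChartAt (𝓡 m) p z, x)
  have hx : ∀ i, ContDiffAt ℝ ∞ (fun w : ℝ × EuclideanSpace ℝ (Fin m) ×
      (Fin m → EuclideanSpace ℝ (Fin m)) => w.2.2 i) w₀ := fun i => by fun_prop
  have hy : ContDiffAt ℝ ∞ (fun w : ℝ × EuclideanSpace ℝ (Fin m) ×
      (Fin m → EuclideanSpace ℝ (Fin m)) => w.2.1) w₀ := by fun_prop
  have hcomp : ∀ f : ℝ → ℝ, ContDiffOn ℝ ∞ f s → ContDiffAt ℝ ∞ (fun w : ℝ ×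
      EuclideanSpace ℝ (Fin m) × (Fin m → EuclideanSpace ℝ (Fin m)) => f w.1) w₀ :=
    fun f hf => (hf.contDiffAt (hs.mem_nhds ht)).comp w₀ contDiffAt_fst
  have hv := (hcomp _ (hκ 0)).smul (hx 0)
  refine hv.prodMk (contDiffAt_pi.2 fun i => ?_)
  refine (ContDiffAt.sum fun k _ =>
    (hcomp _ (contDiffOn_frenetMatrix hκ i k)).smul (hx k)).sub ?_
  exact (contDiffAt_christoffel g hp (κ 0 t • x 0) (x i)).comp w₀ (hy.prodMk (hv.prodMk (hx i)))

/-- The curve and its frame in the chart at `p`. -/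
def frameInChart (p : M) (σ : ℝ → M) (X : Fin m → ∀ t, TangentSpace (𝓡 m) (σ t)) (t : ℝ) :
    EuclideanSpace ℝ (Fin m) × (Fin m → EuclideanSpace ℝ (Fin m)) :=
  (curveInChart m p σ t, fun i => components p σ (X i) t)

/-- A Frenet frame solves the Frenet system in every chart. -/
lemma IsFrenetFrame.hasDerivAt_frameInChart [NeZero m] {g : Metric m M}
    {o : ManifoldOrientation m M} {σ : ℝ → M} {s : Set ℝ} (hs : IsOpen s)
    {X : Fin m → ∀ t, TangentSpace (𝓡 m) (σ t)} {κ : Fin m → ℝ → ℝ}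
    (h : IsFrenetFrame g o σ s X κ) {p : M} {t : ℝ} (ht : t ∈ s)
    (hp : σ t ∈ (extChartAt (𝓡 m) p).source) :
    HasDerivAt (frameInChart p σ X) (frenetField g κ p (t, frameInChart p σ X t)) t := by
  have hX : ∀ j, ContMDiffAt 𝓘(ℝ, ℝ) (𝓡 m) ∞ σ t ∧ ContDiffAt ℝ ∞ (components p σ (X j)) t :=
    fun j => (contMDiffAt_field_iff hp).1 ((h.smooth_frame j).contMDiffAt (hs.mem_nhds ht))
  have hσ : MDifferentiableAt 𝓘(ℝ, ℝ) (𝓡 m) σ t := (hX 0).1.mdifferentiableAt (by simp)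
  have hvel : components p σ (velocity σ) t = κ 0 t • components p σ (X 0) t := by
    rw [components_eq hp, h.velocity_eq t ht, map_smul, components_eq hp]
  refine HasDerivAt.prodMk ?_ (hasDerivAt_pi.2 fun i => ?_)
  · exact (hasDerivAt_curveInChart hσ hp).congr_deriv hvel
  · have hd : DifferentiableAt ℝ (components p σ (X i)) t := (hX i).2.differentiableAt (by simp)
    refine hd.hasDerivAt.congr_deriv ?_
    have h1 := coord_covDerivAlong g hσ hp hd
    rw [h.frenet i t ht, ← sum_frenetMatrix_smul κ t (fun k => X k t), map_sum, hvel] at h1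
    refine eq_sub_of_add_eq (h1.symm.trans (Finset.sum_congr rfl fun k _ => ?_))
    rw [map_smul, ← components_eq hp]
    rfl

/-- Frenet curves with the same curvatures agree near a point at which their frames agree. -/
lemma IsFrenetFrame.eventually_eq [NeZero m] {g : Metric m M}
    {o : ManifoldOrientation m M} {σ σ' : ℝ → M} {s : Set ℝ} (hs : IsOpen s)
    {X : Fin m → ∀ t, TangentSpace (𝓡 m) (σ t)} {X' : Fin m → ∀ t, TangentSpace (𝓡 m) (σ' t)}
    {κ : Fin m → ℝ → ℝ} (h : IsFrenetFrame g o σ s X κ) (h' : IsFrenetFrame g o σ' s X' κ)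
    {p : M} {t : ℝ} (ht : t ∈ s)
    (hp : σ t ∈ (extChartAt (𝓡 m) p).source) (hp' : σ' t ∈ (extChartAt (𝓡 m) p).source)
    (hc : ContinuousAt σ t) (hc' : ContinuousAt σ' t)
    (heq : frameInChart p σ X t = frameInChart p σ' X' t) :
    ∀ᶠ r in 𝓝 t, σ r = σ' r ∧ ∀ q, frameInChart q σ X r = frameInChart q σ' X' r := by
  have hev := eventuallyEq_of_solution (F := frenetField g κ p)
    ((contDiffAt_frenetField g hs h.smooth_curvature hp ht _).of_le (by norm_cast))
    (by
      filter_upwards [hs.mem_nhds ht, eventually_mem_source hc hp] with r hr hrp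
      exact h.hasDerivAt_frameInChart hs hr hrp)
    (by
      filter_upwards [hs.mem_nhds ht, eventually_mem_source hc' hp'] with r hr hrp
      exact h'.hasDerivAt_frameInChart hs hr hrp) heq
  filter_upwards [hev, eventually_mem_source hc hp, eventually_mem_source hc' hp']
    with r hr h1 h2
  have hσ : σ r = σ' r := (extChartAt (𝓡 m) p).injOn h1 h2 (congrArg Prod.fst hr)
  -- Equality in one chart forces equality in the tangent bundle, hence in every chart `q`. The
  -- continuation argument needs this in order to change charts.
  refine ⟨hσ, fun q => Prod.ext (congrArg (extChartAt (𝓡 m) q) hσ) (funext fun i => ?_)⟩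
  have e1 : coord p (σ r) (X i r) = coord p (σ' r) (X' i r) := by
    have := congrFun (congrArg Prod.snd hr) i
    simpa only [frameInChart, components_eq h1, components_eq h2] using this
  have e2 : (⟨σ r, X i r⟩ : TangentBundle (𝓡 m) M) = ⟨σ' r, X' i r⟩ := by
    rw [← coordSymm_coord h1 (X i r), ← coordSymm_coord h2 (X' i r), e1, hσ]
  exact congrArg (fun z : TangentBundle (𝓡 m) M => (tangentTriv m q z).2) e2

/-- Uniqueness of Frenet curves with given curvatures and initial frame. -/
lemma IsFrenetSolution.eqOn [NeZero m] [T2Space M] {g : Metric m M}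
    {o : ManifoldOrientation m M} {x₀ : M} {v : Fin m → TangentSpace (𝓡 m) x₀}
    {κ : Fin m → ℝ → ℝ} {t₀ : ℝ} {s : Set ℝ} (hs : IsOpen s) (hsc : IsPreconnected s)
    (ht₀ : t₀ ∈ s) {σ σ' : ℝ → M} (h : IsFrenetSolution g o x₀ v κ t₀ s σ)
    (h' : IsFrenetSolution g o x₀ v κ t₀ s σ') : EqOn σ σ' s := by
  obtain ⟨⟨hσ, -⟩, X, hX, hx, hv⟩ := h
  obtain ⟨⟨hσ', -⟩, X', hX', hx', hv'⟩ := h'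
  have hc : ∀ t ∈ s, ContinuousAt σ t := fun t ht => (hσ.contMDiffAt (hs.mem_nhds ht)).continuousAt
  have hc' : ∀ t ∈ s, ContinuousAt σ' t :=
    fun t ht => (hσ'.contMDiffAt (hs.mem_nhds ht)).continuousAt
  -- Being a germ condition, `u` is open for free. It remains to see that it contains its limit
  -- points in `s`.
  let u : Set ℝ := {t | ∀ᶠ r in 𝓝 t, σ r = σ' r ∧
    ∀ q, frameInChart q σ X r = frameInChart q σ' X' r}
  have hu : IsOpen u := isOpen_setOfPred_eventually_nhds
  have hsub : s ⊆ u := by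
    refine hsc.subset_of_closure_inter_subset hu ⟨t₀, ht₀, ?_⟩ ?_
    · have h0 : σ t₀ = σ' t₀ := hx.trans hx'.symm
      refine hX.eventually_eq hs hX' (p := σ t₀) ht₀ (mem_extChartAt_source _)
        (h0 ▸ mem_extChartAt_source _) (hc t₀ ht₀) (hc' t₀ ht₀) ?_
      refine Prod.ext (congrArg (extChartAt (𝓡 m) (σ t₀)) h0) (funext fun i => ?_)
      exact congrArg (fun z : TangentBundle (𝓡 m) M => (tangentTriv m (σ t₀) z).2)
        ((hv i).trans (hv' i).symm)
    · rintro t ⟨htu, ht⟩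
      have hfreq : ∃ᶠ r in 𝓝 t, σ r = σ' r ∧
          ∀ q, frameInChart q σ X r = frameInChart q σ' X' r :=
        (mem_closure_iff_frequently.1 htu).mono fun r hr => hr.self_of_nhds
      -- At a limit time the curves agree because `M` is Hausdorff; the frames then agree by
      -- continuity in the chart centred at the limit point.
      have h0 : σ t = σ' t := tendsto_nhds_unique_of_frequently_eq (hc t ht) (hc' t ht)
        (hfreq.mono fun r hr => hr.1)
      have hp : σ t ∈ (extChartAt (𝓡 m) (σ t)).source := mem_extChartAt_source _
      have hp' : σ' t ∈ (extChartAt (𝓡 m) (σ t)).source := h0 ▸ hp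
      refine hX.eventually_eq hs hX' ht hp hp' (hc t ht) (hc' t ht) ?_
      exact tendsto_nhds_unique_of_frequently_eq
        (hX.hasDerivAt_frameInChart hs ht hp).continuousAt
        (hX'.hasDerivAt_frameInChart hs ht hp').continuousAt (hfreq.mono fun r hr => hr.2 _)
  exact fun t ht => (hsub ht).self_of_nhds.1

/-! ### Existence -/

/-- A solution of the Frenet system in a chart, starting from an orthonormal frame, stays
orthonormal. -/
lemma orthonormal_of_frenetField [NeZero m] (g : Metric m M) {κ : Fin m → ℝ → ℝ} {p : M}
    {α : ℝ → EuclideanSpace ℝ (Fin m) × (Fin m → EuclideanSpace ℝ (Fin m))} {a b t₀ : ℝ}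
    (ht₀ : t₀ ∈ Ioo a b) (hα : ∀ t ∈ Ioo a b, (α t).1 ∈ (extChartAt (𝓡 m) p).target ∧
      HasDerivAt α (frenetField g κ p (t, α t)) t)
    (h0 : ∀ i j, metricInChart g p (α t₀).1 ((α t₀).2 i) ((α t₀).2 j) = if i = j then 1 else 0) :
    ∀ t ∈ Ioo a b, ∀ i j,
      metricInChart g p (α t).1 ((α t).2 i) ((α t).2 j) = if i = j then 1 else 0 := by
  refine gram_eq_one_of_antisymm (A := fun t i k => frenetMatrix κ t i k) ht₀
    (fun t i j => frenetMatrix_antisymm κ t i j) (fun t ht i j => ?_) h0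
  obtain ⟨hy, hd⟩ := hα t ht
  have hz : (extChartAt (𝓡 m) p).symm (α t).1 ∈ (extChartAt (𝓡 m) p).source :=
    (extChartAt (𝓡 m) p).map_target hy
  have e : extChartAt (𝓡 m) p ((extChartAt (𝓡 m) p).symm (α t).1) = (α t).1 :=
    (extChartAt (𝓡 m) p).right_inv hy
  have h1 := contDiffAt_metricInChart g hz
  have h2 := isInvertible_metricInChart g hz
  rw [e] at h1 h2
  have hfst : HasDerivAt (fun r => (α r).1) (κ 0 t • (α t).2 0) t :=
    (hasFDerivAt_fst (p := α t)).comp_hasDerivAt t hd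
  have hsnd : ∀ i, HasDerivAt (fun r => (α r).2 i) (∑ k, frenetMatrix κ t i k • (α t).2 k -
      christoffel g p (α t).1 (κ 0 t • (α t).2 0) ((α t).2 i)) t :=
    hasDerivAt_pi.1 ((hasFDerivAt_snd (p := α t)).comp_hasDerivAt t hd)
  -- The covariant derivative of each frame vector is its plain derivative plus the Christoffel term
  -- that the system subtracts, so only the Frenet matrix survives.
  refine (hasDerivAt_metric (h1.differentiableAt (by simp)) h2
    (Eventually.of_forall fun z c d => metricInChart_symm g p z c d) hfst (hsnd i)
    (hsnd j)).congr_deriv ?_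
  simp only [← christoffel_eq, sub_add_cancel, map_sum, map_smul, _root_.sum_apply,
    _root_.smul_apply, smul_eq_mul]

/-- A solution of the Frenet system in the chart at `x₀` yields a Frenet curve. -/
lemma isFrenetSolution_of_frenetField [NeZero m] (g : Metric m M) (o : ManifoldOrientation m M)
    {x₀ : M} {v : Fin m → TangentSpace (𝓡 m) x₀} (hv : IsOrthonormal g x₀ v)
    {κ : Fin m → ℝ → ℝ} {t₀ ε : ℝ} (hε : 0 < ε)
    (hκ : ∀ j, ContDiffOn ℝ ∞ (κ j) (Ioo (t₀ - ε) (t₀ + ε)))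
    (hκ_pos : ∀ j : Fin m, (j : ℕ) + 1 < m → ∀ t ∈ Ioo (t₀ - ε) (t₀ + ε), 0 < κ j t)
    {α : ℝ → EuclideanSpace ℝ (Fin m) × (Fin m → EuclideanSpace ℝ (Fin m))}
    (hα₀ : α t₀ = (extChartAt (𝓡 m) x₀ x₀, fun i => coord x₀ x₀ (v i)))
    (hα : ContDiffOn ℝ ∞ α (Ioo (t₀ - ε) (t₀ + ε)))
    (hα' : ∀ t ∈ Ioo (t₀ - ε) (t₀ + ε), (α t).1 ∈ (extChartAt (𝓡 m) x₀).target ∧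
      HasDerivAt α (frenetField g κ x₀ (t, α t)) t)
    (hor : ∀ t ∈ Ioo (t₀ - ε) (t₀ + ε), LinearIndependent ℝ (fun i => coordSymm x₀
      ((extChartAt (𝓡 m) x₀).symm (α t).1) ((α t).2 i)) → IsPositivelyOriented o
      ((extChartAt (𝓡 m) x₀).symm (α t).1) (fun i => coordSymm x₀
      ((extChartAt (𝓡 m) x₀).symm (α t).1) ((α t).2 i))) :
    IsFrenetSolution g o x₀ v κ t₀ (Ioo (t₀ - ε) (t₀ + ε))
      (fun t => (extChartAt (𝓡 m) x₀).symm (α t).1) := by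
  set s := Ioo (t₀ - ε) (t₀ + ε) with hs_def
  have hs : IsOpen s := isOpen_Ioo
  have ht₀ : t₀ ∈ s := by simp [hs_def, hε]
  let σ : ℝ → M := fun t => (extChartAt (𝓡 m) x₀).symm (α t).1
  let X : Fin m → ∀ t, TangentSpace (𝓡 m) (σ t) := fun i t => coordSymm x₀ (σ t) ((α t).2 i)
  have hmem : ∀ t ∈ s, σ t ∈ (extChartAt (𝓡 m) x₀).source := fun t ht =>
    (extChartAt (𝓡 m) x₀).map_target (hα' t ht).1
  have hσe : ∀ t ∈ s, extChartAt (𝓡 m) x₀ (σ t) = (α t).1 := fun t ht =>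
    (extChartAt (𝓡 m) x₀).right_inv (hα' t ht).1
  have hcomp : ∀ i, ∀ t ∈ s, components x₀ σ (X i) t = (α t).2 i := fun i t ht => by
    rw [components_eq (hmem t ht), coord_coordSymm (hmem t ht)]
  have hev : ∀ t ∈ s, curveInChart m x₀ σ =ᶠ[𝓝 t] fun r => (α r).1 := fun t ht =>
    eventually_of_mem (hs.mem_nhds ht) hσe
  have hevc : ∀ i, ∀ t ∈ s, components x₀ σ (X i) =ᶠ[𝓝 t] fun r => (α r).2 i := fun i t ht =>
    eventually_of_mem (hs.mem_nhds ht) (hcomp i)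
  have hσ : ∀ t ∈ s, ContMDiffAt 𝓘(ℝ, ℝ) (𝓡 m) ∞ σ t := fun t ht =>
    ((contMDiffOn_extChartAt_symm (I := 𝓡 m) (n := ∞) x₀).contMDiffAt
      ((isOpen_extChartAt_target x₀).mem_nhds (hα' t ht).1)).comp t
      (contDiff_fst.contDiffAt.comp t (hα.contDiffAt (hs.mem_nhds ht))).contMDiffAt
  have hcs : ∀ i, ∀ t ∈ s, ContDiffAt ℝ ∞ (components x₀ σ (X i)) t := fun i t ht =>
    ((contDiff_apply ℝ _ i).contDiffAt.comp t (contDiff_snd.contDiffAt.comp t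
      (hα.contDiffAt (hs.mem_nhds ht)))).congr_of_eventuallyEq (hevc i t ht)
  have hXs : ∀ i, ContMDiffOn 𝓘(ℝ, ℝ) (𝓡 m).tangent ∞
      (fun t => (⟨σ t, X i t⟩ : TangentBundle (𝓡 m) M)) s := fun i t ht =>
    ((contMDiffAt_field_iff (hmem t ht)).2 ⟨hσ t ht, hcs i t ht⟩).contMDiffWithinAt
  have hσd : ∀ t ∈ s, MDifferentiableAt 𝓘(ℝ, ℝ) (𝓡 m) σ t := fun t ht =>
    (hσ t ht).mdifferentiableAt (by simp)
  have hvelc : ∀ t ∈ s, components x₀ σ (velocity σ) t = κ 0 t • (α t).2 0 := fun t ht =>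
    (hasDerivAt_curveInChart (hσd t ht) (hmem t ht)).unique
      (((hasFDerivAt_fst (p := α t)).comp_hasDerivAt t (hα' t ht).2).congr_of_eventuallyEq
        (hev t ht))
  have hvel : ∀ t ∈ s, velocity σ t = κ 0 t • X 0 t := fun t ht => by
    apply coord_injective (hmem t ht)
    rw [← components_eq (hmem t ht), hvelc t ht, map_smul, coord_coordSymm (hmem t ht)]
  have hfr : ∀ i, ∀ t ∈ s, covDerivAlong g σ (X i) t = ∑ k, frenetMatrix κ t i k • X k t := by
    intro i t ht
    apply coord_injective (hmem t ht)
    have hd : HasDerivAt (components x₀ σ (X i)) (∑ k, frenetMatrix κ t i k • (α t).2 k -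
        christoffel g x₀ (α t).1 (κ 0 t • (α t).2 0) ((α t).2 i)) t :=
      (hasDerivAt_pi.1 ((hasFDerivAt_snd (p := α t)).comp_hasDerivAt t (hα' t ht).2)
        i).congr_of_eventuallyEq (hevc i t ht)
    rw [coord_covDerivAlong g (hσd t ht) (hmem t ht) hd.differentiableAt, hd.deriv, hvelc t ht,
      hcomp i t ht, hσe t ht, sub_add_cancel, map_sum]
    exact Finset.sum_congr rfl fun k _ => by rw [map_smul, coord_coordSymm (hmem t ht)]
  have hσ₀ : σ t₀ = x₀ := by
    simp only [σ, hα₀]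
    exact extChartAt_to_inv x₀
  have hX₀ : ∀ i, (⟨σ t₀, X i t₀⟩ : TangentBundle (𝓡 m) M) = ⟨x₀, v i⟩ := by
    intro i
    -- The base point is generalized so that `σ t₀ = x₀` can be substituted inside the dependent
    -- tangent spaces.
    have : ∀ y, y = x₀ → (⟨y, coordSymm x₀ y (coord x₀ x₀ (v i))⟩ : TangentBundle (𝓡 m) M) =
        ⟨x₀, v i⟩ := by
      rintro y rfl
      rw [coordSymm_coord (mem_extChartAt_source _)]
    simp only [X]
    rw [show (α t₀).2 i = coord x₀ x₀ (v i) by rw [hα₀]]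
    exact this _ hσ₀
  have horth : ∀ t ∈ s, IsOrthonormal g (σ t) (fun i => X i t) := by
    intro t ht i j
    have := orthonormal_of_frenetField g ht₀ hα' (fun i j => by
      rw [hα₀]
      simp only
      rw [metricInChart_coord g (mem_extChartAt_source _)]
      exact hv i j) t ht i j
    rwa [← hσe t ht, metricInChart_eq g (hmem t ht)] at this
  have hosc := osculating_of_frenet g hs hXs hκ hκ_pos hvel hfr
  refine ⟨⟨fun t ht => (hσ t ht).contMDiffWithinAt, fun t ht => ?_⟩, X,
    ⟨hXs, hκ, hκ_pos, horth, fun t ht => hor t ht (horth t ht).linearIndependent,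
      fun k _ hk => hosc k hk, hvel, fun i t ht => ?_⟩, hσ₀, hX₀⟩
  -- General position is the osculating condition for `k = m - 1`, whose frame vectors are
  -- independent.
  · have hm : m - 1 < m := Nat.sub_lt (Nat.pos_of_neZero m) one_pos
    refine (hosc (m - 1) hm t ht).linearIndependent ?_
    exact (horth t ht).linearIndependent.comp (fun i : Fin (m - 1) => ⟨i, i.isLt.trans hm⟩)
      fun a b hab => Fin.ext (by simpa using hab)
  · rw [hfr i t ht, ← sum_frenetMatrix_smul κ t (fun k => X k t)]

lemma exists_isFrenetSolution [NeZero m] (g : Metric m M) (o : ManifoldOrientation m M)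
    (x₀ : M) (v : Fin m → TangentSpace (𝓡 m) x₀) (hv : IsOrthonormal g x₀ v)
    (hv' : IsPositivelyOriented o x₀ v) (t₀ δ : ℝ) (hδ : 0 < δ) (κ : Fin m → ℝ → ℝ)
    (hκ : ∀ j, ContDiffOn ℝ ∞ (κ j) (Ioo (t₀ - δ) (t₀ + δ)))
    (hκ_pos : ∀ j : Fin m, (j : ℕ) + 1 < m → ∀ t ∈ Ioo (t₀ - δ) (t₀ + δ), 0 < κ j t) :
    ∃ ε : ℝ, 0 < ε ∧ ε ≤ δ ∧ ∃ σ : ℝ → M,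
      IsFrenetSolution g o x₀ v κ t₀ (Ioo (t₀ - ε) (t₀ + ε)) σ := by
  have hx₀ : x₀ ∈ (extChartAt (𝓡 m) x₀).source := mem_extChartAt_source _
  obtain ⟨α, hα₀, ε, hε, hα, hα'⟩ := exists_smooth_solution (F := frenetField g κ x₀)
    -- Keeping the solution in `U` keeps the curve inside the chart at `x₀`; the frame components
    -- are unconstrained.
    (U := Ioo (t₀ - δ) (t₀ + δ) ×ˢ ((extChartAt (𝓡 m) x₀).target ×ˢ univ))
    (isOpen_Ioo.prod ((isOpen_extChartAt_target x₀).prod isOpen_univ))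
    (by
      rintro ⟨t, y, x⟩ ⟨ht, hy, -⟩
      simp only at ht hy
      rw [← (extChartAt (𝓡 m) x₀).right_inv hy]
      exact (contDiffAt_frenetField g isOpen_Ioo hκ ((extChartAt (𝓡 m) x₀).map_target hy) ht
        x).contDiffWithinAt)
    (t₀ := t₀) (z₀ := (extChartAt (𝓡 m) x₀ x₀, fun i => coord x₀ x₀ (v i)))
    ⟨by simp [hδ], (extChartAt (𝓡 m) x₀).map_source hx₀, mem_univ _⟩
  let σ : ℝ → M := fun t => (extChartAt (𝓡 m) x₀).symm (α t).1
  let X : Fin m → ∀ t, TangentSpace (𝓡 m) (σ t) := fun i t => coordSymm x₀ (σ t) ((α t).2 i)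
  have ht₀ : t₀ ∈ Ioo (t₀ - ε) (t₀ + ε) := by simp [hε]
  have hσ₀ : σ t₀ = x₀ := by
    simp only [σ, hα₀]
    exact extChartAt_to_inv x₀
  have hαc : ContinuousAt α t₀ := (hα' t₀ ht₀).2.continuousAt
  have hσc : ContinuousAt σ t₀ := by
    refine ContinuousAt.comp (f := fun t => (α t).1) (g := (extChartAt (𝓡 m) x₀).symm) ?_
      (continuous_fst.continuousAt.comp hαc)
    rw [hα₀]
    exact continuousAt_extChartAt_symm x₀
  have hcomp : ∀ i, components (σ t₀) σ (X i) =ᶠ[𝓝 t₀] fun t => (α t).2 i := by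
    intro i
    filter_upwards [isOpen_Ioo.mem_nhds ht₀] with t ht
    have hm : σ t ∈ (extChartAt (𝓡 m) x₀).source :=
      (extChartAt (𝓡 m) x₀).map_target (hα' t ht).1.2.1
    rw [hσ₀, components_eq hm, coord_coordSymm hm]
  have hX₀ : IsPositivelyOriented o (σ t₀) (fun i => X i t₀) := by
    have : ∀ y, y = x₀ → IsPositivelyOriented o y
        (fun i => coordSymm x₀ y (coord x₀ x₀ (v i))) := by
      rintro y rfl
      simpa only [coordSymm_coord (mem_extChartAt_source _)] using hv'
    simp only [X]
    rw [show (α t₀).2 = fun i => coord x₀ x₀ (v i) by rw [hα₀]]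
    exact this _ hσ₀
  have hor := eventually_isPositivelyOriented o hσc (X := X) (fun i =>
    ((continuous_apply i).continuousAt.comp (continuous_snd.continuousAt.comp hαc)).congr
      (hcomp i).symm) hX₀
  obtain ⟨η, hη, hηo⟩ := Metric.eventually_nhds_iff_ball.1 hor
  rw [Real.ball_eq_Ioo] at hηo
  -- The three bounds secure the solution, the orientation and the given curvatures.
  let r := min (min ε η) δ
  have hr : 0 < r := lt_min (lt_min hε hη) hδ
  have hrε : r ≤ ε := (min_le_left _ _).trans (min_le_left _ _)
  have hrη : r ≤ η := (min_le_left _ _).trans (min_le_right _ _)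
  have hrδ : r ≤ δ := min_le_right _ _
  have hsub : ∀ {c : ℝ}, r ≤ c → Ioo (t₀ - r) (t₀ + r) ⊆ Ioo (t₀ - c) (t₀ + c) := fun h =>
    Ioo_subset_Ioo (by linarith) (by linarith)
  exact ⟨r, hr, hrδ, σ, isFrenetSolution_of_frenetField g o hv hr
    (fun j => (hκ j).mono (hsub hrδ)) (fun j hj t ht => hκ_pos j hj t (hsub hrδ ht)) hα₀
    (hα.mono (hsub hrε)) (fun t ht => ⟨(hα' t (hsub hrε ht)).1.2.1, (hα' t (hsub hrε ht)).2⟩)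
    fun t ht => hηo t (hsub hrη ht)⟩

end FrenetTheory

end

theorem mainTheorem6 {m : ℕ} [NeZero m] {M : Type*} [TopologicalSpace M] [T2Space M]
    [ChartedSpace (EuclideanSpace ℝ (Fin m)) M] [IsManifold (𝓡 m) ∞ M]
    (g : FrenetTheory.Metric m M) (o : FrenetTheory.ManifoldOrientation m M)
    (x₀ : M) (v : Fin m → TangentSpace (𝓡 m) x₀)
    (hv : FrenetTheory.IsOrthonormal g x₀ v)
    (hv' : FrenetTheory.IsPositivelyOriented o x₀ v)
    (t₀ δ : ℝ) (hδ : 0 < δ) (κ : Fin m → ℝ → ℝ)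
    (hκ : ∀ j, ContDiffOn ℝ ∞ (κ j) (Ioo (t₀ - δ) (t₀ + δ)))
    (hκ_pos : ∀ j : Fin m, (j : ℕ) + 1 < m → ∀ t ∈ Ioo (t₀ - δ) (t₀ + δ), 0 < κ j t) :
    ∃ ε : ℝ, 0 < ε ∧ ε ≤ δ ∧
      ∃ σ : ℝ → M,
        FrenetTheory.IsFrenetSolution g o x₀ v κ t₀ (Ioo (t₀ - ε) (t₀ + ε)) σ ∧
        ∀ σ' : ℝ → M,
          FrenetTheory.IsFrenetSolution g o x₀ v κ t₀ (Ioo (t₀ - ε) (t₀ + ε)) σ' →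
          EqOn σ' σ (Ioo (t₀ - ε) (t₀ + ε)) := by
  obtain ⟨ε, hε, hεδ, σ, hσ⟩ :=
    FrenetTheory.exists_isFrenetSolution g o x₀ v hv hv' t₀ δ hδ κ hκ hκ_pos
  exact ⟨ε, hε, hεδ, σ, hσ, fun σ' hσ' =>
    hσ'.eqOn isOpen_Ioo isPreconnected_Ioo (by simp [hε]) hσ⟩
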